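/- Consider a bandit problem with $k\ge 2$ arms and a known horizon of $T\ge 1$ rounds. In round $t$ arm $i$ carries a reward $g_i(t)\in[0,1]$; the learner chooses an arm $i_t$ (whose reward it collects without observing it) and queries an arm $j_t$, observing $g_{j_t}(t)$. The regret is $\max_{i}\sum_{t=1}^T g_i(t)-\sum_{t=1}^T g_{i_t}(t)$. The decoupled algorithm with step size parameter $\mu\in[1,k]$ and confidence parameter $\delta\in(0,1)$ sets $\eta=1/\sqrt{\mu T}$, $\beta=2\eta\sqrt{6\log(3k/\delta)}$, $\gamma=\min\{1,\eta^2(1+\beta)^2k^2\}$ and $w_j(1)=1$ for all arms $j$. In each round $t=1,\dots,T$ it puts $p_j(t)=(1-\gamma)\,w_j(t)/\sum_l w_l(t)+\gamma/k$ and $q_j(t)=\sqrt{p_j(t)}/\sum_l\sqrt{p_l(t)}$, draws $i_t$ from $p(t)$ and $j_t$ from $q(t)$ (with fresh independent randomness), and updates $w_j(t+1)=w_j(t)\exp(\eta\tilde g_j(t))$, where $\tilde g_j(t)=\bigl(g_j(t)\mathbf 1_{j_t=j}+\beta\bigr)/q_j(t)$. Theorem. There is an absolute exponent $a\in\mathbb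 N$, and for every $m\in\mathbb N$ and $\Delta>0$ there is a constant $C=C(m,\Delta)>0$, such that the following holds for all $k\ge2$, $T\ge1$ and $\delta\in(0,1)$. Suppose the reward vectors $(g_1(t),\dots,g_k(t))$, $t=1,\dots,T$, are i.i.d. over the rounds with values in $[0,1]^k$ (the arms may be dependent or independent within a round), and that there is a nonempty set $G\subset[k]$ with $|G|=m$ such that the expected reward of every arm in $G$ is larger than the expected reward of every arm in $[k]\setminus G$ by at least $\Delta$. If the algorithm is run with confidence parameter $\delta$ and \[\mu=k^{\min\{1,\max\{0,\frac43-\frac13\log_k T\}\}},\] then with probability at least $1-\delta$ over the rewards and the algorithm's randomness, its regret is at most \[C\,\bigl(\log(3k/\delta)\bigr)^{a}\,\sqrt{k^{\max\{0,\frac43-\frac13\log_k T\}}\,T}.\] -/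

import Mathlib

namespace DecoupledMAB

noncomputable section

/-- The step size `η = 1 / √(μ T)`. -/
def eta (μ : ℝ) (T : ℕ) : ℝ := 1 / √(μ * T)

/-- The confidence width `β = 2 η √(6 log (3 k / δ))`. -/
def beta (k : ℕ) (μ δ : ℝ) (T : ℕ) : ℝ := 2 * eta μ T * √(6 * Real.log (3 * k / δ))

/-- The mixing coefficient `γ = η² (1 + β)² k²`. It is a mixture weight, hence capped at `1`:
without the cap the vector `p(t)` below need not be a probability vector. -/
def gamma (k : ℕ) (μ δ : ℝ) (T : ℕ) : ℝ :=
  min 1 (eta μ T ^ 2 * (1 + beta k μ δ T) ^ 2 * (k : ℝ) ^ 2)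

/-- Exploitation probabilities computed from the weights:
`p_j = (1 - γ) w_j / ∑ l, w_l + γ / k`. -/
def pVec (k : ℕ) (μ δ : ℝ) (T : ℕ) (w : Fin k → ℝ) (j : Fin k) : ℝ :=
  (1 - gamma k μ δ T) * (w j / ∑ l, w l) + gamma k μ δ T / k

/-- Query probabilities: `q_j = √p_j / ∑ l, √p_l`. -/
def qVec (k : ℕ) (μ δ : ℝ) (T : ℕ) (w : Fin k → ℝ) (j : Fin k) : ℝ :=
  √(pVec k μ δ T w j) / ∑ l, √(pVec k μ δ T w l)

/-- The weights after `n` rounds. The rewards are `g t i` (round `t = 0, 1, …`, arm `i`); the entry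
`h t = (i_t, j_t)` of the history records the chosen and the queried arm of round `t`.
The update is `w_j ← w_j exp (η g̃_j)` with `g̃_j = (g_j 1[j_t = j] + β) / q_j`. -/
def weight (k : ℕ) (μ δ : ℝ) (T : ℕ) (g : ℕ → Fin k → ℝ) :
    (n : ℕ) → (Fin n → Fin k × Fin k) → Fin k → ℝ
  | 0, _ => fun _ => 1
  | n + 1, h => fun j =>
      let w := weight k μ δ T g n (Fin.init h)
      w j * Real.exp (eta μ T *
        (((if (h (Fin.last n)).2 = j then g n j else 0) + beta k μ δ T) / qVec k μ δ T w j))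

section Probabilities

variable {k : ℕ} {μ δ : ℝ} {T : ℕ}

lemma weight_pos (g : ℕ → Fin k → ℝ) (n : ℕ) (h : Fin n → Fin k × Fin k) (j : Fin k) :
    0 < weight k μ δ T g n h j := by
  induction n with
  | zero => simp [weight]
  | succ n ih => exact mul_pos (ih _) (Real.exp_pos _)

lemma gamma_nonneg : 0 ≤ gamma k μ δ T := le_min zero_le_one (by positivity)

lemma gamma_le_one : gamma k μ δ T ≤ 1 := min_le_left _ _

lemma pVec_nonneg {w : Fin k → ℝ} (hw : ∀ j, 0 < w j) (j : Fin k) :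
    0 ≤ pVec k μ δ T w j := by
  have h1 : 0 ≤ 1 - gamma k μ δ T := sub_nonneg.2 gamma_le_one
  have h2 : 0 ≤ ∑ l, w l := Finset.sum_nonneg fun l _ => (hw l).le
  exact add_nonneg (mul_nonneg h1 (div_nonneg (hw j).le h2))
    (div_nonneg gamma_nonneg (Nat.cast_nonneg k))

lemma pVec_sum [NeZero k] {w : Fin k → ℝ} (hw : ∀ j, 0 < w j) :
    ∑ j, pVec k μ δ T w j = 1 := by
  have h2 : 0 < ∑ l, w l :=
    Finset.sum_pos (fun l _ => hw l) ⟨0, Finset.mem_univ _⟩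
  have hk : (k : ℝ) ≠ 0 := Nat.cast_ne_zero.2 (NeZero.ne k)
  simp only [pVec, Finset.sum_add_distrib, ← Finset.mul_sum, ← Finset.sum_div]
  rw [div_self h2.ne']
  simp only [Finset.sum_const, Finset.card_univ, Fintype.card_fin, nsmul_eq_mul]
  field_simp
  ring

lemma qVec_nonneg (w : Fin k → ℝ) (j : Fin k) : 0 ≤ qVec k μ δ T w j :=
  div_nonneg (Real.sqrt_nonneg _) (Finset.sum_nonneg fun _ _ => Real.sqrt_nonneg _)

lemma qVec_sum [NeZero k] {w : Fin k → ℝ} (hw : ∀ j, 0 < w j) :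
    ∑ j, qVec k μ δ T w j = 1 := by
  have hpos : 0 < ∑ l, √(pVec k μ δ T w l) := by
    obtain ⟨j, hj⟩ : ∃ j, 0 < pVec k μ δ T w j := by
      by_contra! hcon
      have := Finset.sum_nonpos (s := Finset.univ) fun j _ => hcon j
      rw [pVec_sum hw] at this
      linarith
    exact Finset.sum_pos' (fun _ _ => Real.sqrt_nonneg _)
      ⟨j, Finset.mem_univ _, Real.sqrt_pos.2 hj⟩
  simp only [qVec, ← Finset.sum_div]
  exact div_self hpos.ne'

lemma sum_ofReal_eq_one {f : Fin k → ℝ} (h0 : ∀ j, 0 ≤ f j) (h1 : ∑ j, f j = 1) :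
    ∑ j, ENNReal.ofReal (f j) = 1 := by
  rw [← ENNReal.ofReal_sum_of_nonneg fun j _ => h0 j, h1, ENNReal.ofReal_one]

end Probabilities

/-- The law of the arm chosen after the history `h` of `n` rounds. -/
def choosePMF (k : ℕ) [NeZero k] (μ δ : ℝ) (T : ℕ) (g : ℕ → Fin k → ℝ) (n : ℕ)
    (h : Fin n → Fin k × Fin k) : PMF (Fin k) :=
  PMF.ofFintype (fun i => ENNReal.ofReal (pVec k μ δ T (weight k μ δ T g n h) i))
    (sum_ofReal_eq_one (pVec_nonneg (weight_pos g n h)) (pVec_sum (weight_pos g n h)))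

/-- The law of the arm queried after the history `h` of `n` rounds. -/
def queryPMF (k : ℕ) [NeZero k] (μ δ : ℝ) (T : ℕ) (g : ℕ → Fin k → ℝ) (n : ℕ)
    (h : Fin n → Fin k × Fin k) : PMF (Fin k) :=
  PMF.ofFintype (fun j => ENNReal.ofReal (qVec k μ δ T (weight k μ δ T g n h) j))
    (sum_ofReal_eq_one (qVec_nonneg _) (qVec_sum (weight_pos g n h)))

/-- The law of the first `n` pairs (chosen arm, queried arm) produced by the decoupled bandit
algorithm with step size parameter `μ`, confidence parameter `δ` and horizon `T`, on the fixed
reward sequence `g`. -/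
def run (k : ℕ) [NeZero k] (μ δ : ℝ) (T : ℕ) (g : ℕ → Fin k → ℝ) :
    (n : ℕ) → PMF (Fin n → Fin k × Fin k)
  | 0 => PMF.pure Fin.elim0
  | n + 1 =>
      (run k μ δ T g n).bind fun h =>
        (choosePMF k μ δ T g n h).bind fun i =>
          (queryPMF k μ δ T g n h).bind fun j =>
            PMF.pure (Fin.snoc (α := fun _ => Fin k × Fin k) h (i, j))

/-- The regret `max_i ∑ t, g_i(t) - ∑ t, g_{i_t}(t)` over `T` rounds. -/
def regret {k : ℕ} (T : ℕ) (g : ℕ → Fin k → ℝ) (h : Fin T → Fin k × Fin k) : ℝ :=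
  (⨆ i : Fin k, ∑ t : Fin T, g t i) - ∑ t : Fin T, g t (h t).1

end

end DecoupledMAB

/-! Write S(t) = ∑ √p_l(t). The choice q ∝ √p makes ∑ p_j/q_j = S² and p_j/q_j² = S² for every j, so
the usual exponential weights analysis bounds η · regret by ηγT + log k + O(log(k/δ)) plus (ηβ +
8η²) ∑ S(t)² (`regret_le`). Always S² ≤ k; the improvement comes from showing that S² is of constant
order, up to 2kγ, after O(log k / (ηΔ)) rounds.

For this, every arm outside G is compared with a barrier: its weight relative to the total weight of
G should stay below e · max(exp(-ηΔn/2), 1/k²). The barrier sinks at half the speed that the gap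
provides, so the log-distance of an arm to the barrier has negative drift. It stops at order 1/k²,
which suffices because then k√B = O(1), and which is needed because an arm near the barrier is then
still queried with probability at least of order 1/(mk). This controls bias and variance of its gain
estimate (`one_div_qVec_le_of_near_barrier`, `sum_exp_drift_le`). Hence exp(λ · log-excess), with λ
of order Δ/(m²kη), does not grow in mean near the barrier; far below it, one update cannot come near
it. Each round adds at most k exp(-λ) to the expected sum (`BarrierRegime.isAlmostSupermartingale`),
so no crossing occurs with high probability once λ ≥ log(4kT/δ).

Two further exponential supermartingales compare true with estimated gains of each arm, and
collected with importance weighted gains. All are added into `failurePotential`, and a single Markov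
inequality over rewards and algorithm (`IsAlmostSupermartingale.one_sub_le_lintegral`) gives the
probability bound. Only the means of the rewards enter the drift, through an affine bound in the
reward vector, so dependence between arms is harmless.

Let s be the claimed rate √(k^E T). It satisfies T ≤ s² and k²T ≤ s³, and η = 1/s when T ≥ k; these
inequalities bound every term by polylogarithmic factors times s (`regret_bound_arith`). If T < k,
or if s is too small for λ ≥ log(4kT/δ), the rate already exceeds the trivial bound T on the regret.
-/

namespace DecoupledMAB

open MeasureTheory

noncomputable section

/-! ### Histories, adapted processes and measurability -/

section Histories

variable {k : ℕ} {μ δ : ℝ} {T : ℕ}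

/-- The weights after one update from `w` with reward vector `y` and queried arm `J`. -/
def nextWeight (k : ℕ) (μ δ : ℝ) (T : ℕ) (w y : Fin k → ℝ) (J j : Fin k) : ℝ :=
  w j * Real.exp (eta μ T * (((if J = j then y j else 0) + beta k μ δ T) / qVec k μ δ T w j))

/-- The sum over the first `n` rounds of a functional of the round, the current weights, the
reward vector and the pair (chosen arm, queried arm). -/
def cumul (k : ℕ) (μ δ : ℝ) (T : ℕ)
    (F : ℕ → (Fin k → ℝ) → (Fin k → ℝ) → Fin k × Fin k → ℝ) (g : ℕ → Fin k → ℝ) :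
    (n : ℕ) → (Fin n → Fin k × Fin k) → ℝ
  | 0, _ => 0
  | n + 1, h => cumul k μ δ T F g n (Fin.init h) +
      F n (weight k μ δ T g n (Fin.init h)) (g n) (h (Fin.last n))

/-- The reward sequence that starts with `x` and vanishes afterwards. -/
def extendZero {n : ℕ} (x : Fin n → Fin k → ℝ) (t : ℕ) : Fin k → ℝ :=
  if h : t < n then x ⟨t, h⟩ else 0

/-- A history extended by one more round. -/
abbrev snocHist {n : ℕ} (h : Fin n → Fin k × Fin k) (a : Fin k × Fin k) :
    Fin (n + 1) → Fin k × Fin k :=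
  Fin.snoc (α := fun _ => Fin k × Fin k) h a

lemma weight_snoc (g : ℕ → Fin k → ℝ) (n : ℕ) (h : Fin n → Fin k × Fin k) (a : Fin k × Fin k) :
    weight k μ δ T g (n + 1) (snocHist h a) =
      nextWeight k μ δ T (weight k μ δ T g n h) (g n) a.2 := by
  funext j
  simp [weight, nextWeight, snocHist, Fin.init_snoc, Fin.snoc_last]

lemma weight_succ (g : ℕ → Fin k → ℝ) (n : ℕ) (h : Fin (n + 1) → Fin k × Fin k) :
    weight k μ δ T g (n + 1) h =
      nextWeight k μ δ T (weight k μ δ T g n (Fin.init h)) (g n) (h (Fin.last n)).2 := rfl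

lemma weight_congr {g g' : ℕ → Fin k → ℝ} {n : ℕ} (hg : ∀ t < n, g t = g' t)
    (h : Fin n → Fin k × Fin k) : weight k μ δ T g n h = weight k μ δ T g' n h := by
  induction n with
  | zero => rfl
  | succ n ih =>
    rw [weight_succ, weight_succ, ih (fun t ht => hg t (by omega)), hg n (by omega)]

lemma weight_update (g : ℕ → Fin k → ℝ) (n : ℕ) (y : Fin k → ℝ) (h : Fin n → Fin k × Fin k) :
    weight k μ δ T (Function.update g n y) n h = weight k μ δ T g n h :=
  weight_congr (fun t ht => by rw [Function.update_of_ne (by omega)]) h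

lemma weight_update_snoc (g : ℕ → Fin k → ℝ) (n : ℕ) (y : Fin k → ℝ) (h : Fin n → Fin k × Fin k)
    (a : Fin k × Fin k) :
    weight k μ δ T (Function.update g n y) (n + 1) (snocHist h a) =
      nextWeight k μ δ T (weight k μ δ T g n h) y a.2 := by
  rw [weight_snoc, weight_update, Function.update_self]

section Cumul

variable {F : ℕ → (Fin k → ℝ) → (Fin k → ℝ) → Fin k × Fin k → ℝ}

lemma cumul_congr {g g' : ℕ → Fin k → ℝ} {n : ℕ} (hg : ∀ t < n, g t = g' t)
    (h : Fin n → Fin k × Fin k) : cumul k μ δ T F g n h = cumul k μ δ T F g' n h := by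
  induction n with
  | zero => rfl
  | succ n ih =>
    rw [cumul, cumul, ih (fun t ht => hg t (by omega)), hg n (by omega),
      weight_congr (fun t ht => hg t (by omega))]

lemma cumul_update_snoc (g : ℕ → Fin k → ℝ) (n : ℕ) (y : Fin k → ℝ) (h : Fin n → Fin k × Fin k)
    (a : Fin k × Fin k) :
    cumul k μ δ T F (Function.update g n y) (n + 1) (snocHist h a) =
      cumul k μ δ T F g n h + F n (weight k μ δ T g n h) y a := by
  simp only [cumul, snocHist, Fin.init_snoc, Fin.snoc_last, Function.update_self, weight_update]
  rw [cumul_congr (fun t ht => by rw [Function.update_of_ne (by omega)])]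

end Cumul

section Measurability

lemma measurable_pVec (j : Fin k) : Measurable fun w : Fin k → ℝ => pVec k μ δ T w j := by
  unfold pVec
  fun_prop

lemma measurable_qVec (j : Fin k) : Measurable fun w : Fin k → ℝ => qVec k μ δ T w j := by
  unfold qVec
  exact (measurable_pVec j).sqrt.div
    (Finset.measurable_sum _ fun l _ => (measurable_pVec l).sqrt)

lemma measurable_nextWeight (J : Fin k) :
    Measurable fun z : (Fin k → ℝ) × (Fin k → ℝ) => nextWeight k μ δ T z.1 z.2 J := by
  refine measurable_pi_iff.2 fun j => ?_
  have hq : Measurable fun z : (Fin k → ℝ) × (Fin k → ℝ) => qVec k μ δ T z.1 j :=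
    (measurable_qVec j).comp measurable_fst
  have h1 : Measurable fun z : (Fin k → ℝ) × (Fin k → ℝ) => if J = j then z.2 j else 0 := by
    split_ifs <;> fun_prop
  unfold nextWeight
  exact ((measurable_pi_apply j).comp measurable_fst).mul
    (((h1.add_const _).div hq).const_mul _).exp

lemma measurable_weight (n : ℕ) (h : Fin n → Fin k × Fin k) :
    Measurable fun g : ℕ → Fin k → ℝ => weight k μ δ T g n h := by
  induction n with
  | zero => exact measurable_const
  | succ n ih =>
    simp only [weight_succ]
    exact (measurable_nextWeight (h (Fin.last n)).2).comp
      ((ih (Fin.init h)).prodMk (measurable_pi_apply n))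

lemma measurable_cumul {F : ℕ → (Fin k → ℝ) → (Fin k → ℝ) → Fin k × Fin k → ℝ}
    (hF : ∀ n a, Measurable fun z : (Fin k → ℝ) × (Fin k → ℝ) => F n z.1 z.2 a)
    (n : ℕ) (h : Fin n → Fin k × Fin k) :
    Measurable fun g : ℕ → Fin k → ℝ => cumul k μ δ T F g n h := by
  induction n with
  | zero => exact measurable_const
  | succ n ih =>
    simp only [cumul]
    exact (ih (Fin.init h)).add ((hF n (h (Fin.last n))).comp
      ((measurable_weight n (Fin.init h)).prodMk (measurable_pi_apply n)))

lemma measurable_extendZero (n : ℕ) :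
    Measurable fun x : Fin n → Fin k → ℝ => extendZero x := by
  refine measurable_pi_iff.2 fun t => ?_
  unfold extendZero
  split_ifs <;> fun_prop

end Measurability

lemma extendZero_snoc {n : ℕ} (x : Fin n → Fin k → ℝ) (y : Fin k → ℝ) :
    extendZero (Fin.snoc (α := fun _ => Fin k → ℝ) x y) =
      Function.update (extendZero x) n y := by
  funext t
  rcases lt_trichotomy t n with ht | rfl | ht
  · rw [Function.update_of_ne (by omega)]
    simp [extendZero, Fin.snoc, ht, Nat.lt_succ_of_lt ht]
  · simp [extendZero, Fin.snoc]
  · rw [Function.update_of_ne (by omega)]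
    simp [extendZero, show ¬ t < n + 1 by omega, show ¬ t < n by omega]

lemma sum_snocHist {M : Type*} [AddCommMonoid M] {n : ℕ}
    (f : (Fin (n + 1) → Fin k × Fin k) → M) :
    ∑ h, f h = ∑ h : Fin n → Fin k × Fin k, ∑ i, ∑ j, f (snocHist h (i, j)) := by
  rw [← (Fin.snocEquiv fun _ : Fin (n + 1) => Fin k × Fin k).sum_comp, Fintype.sum_prod_type,
    Finset.sum_comm]
  refine Finset.sum_congr rfl fun h _ => ?_
  rw [Fintype.sum_prod_type]
  rfl

/-! ### Almost supermartingales over rewards and algorithm -/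

section Supermartingale

/-- On rewards in the unit cube, `f` is bounded by an affine function whose mean under `ν` is at
most `v`. -/
def HasAffineBound (ν : Measure (Fin k → ℝ)) (f : (Fin k → ℝ) → ℝ) (v : ℝ) : Prop :=
  ∃ (a₀ : ℝ) (a : Fin k → ℝ),
    (∀ y : Fin k → ℝ, (∀ i, y i ∈ Set.Icc (0 : ℝ) 1) → f y ≤ a₀ + ∑ l, a l * y l) ∧
    a₀ + ∑ l, a l * ∫ x, x l ∂ν ≤ v

/-- A nonnegative adapted process whose conditional expectation grows by at most `c` per round.
The conditional expectation over the randomness of the algorithm is bounded by an affine function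
of the reward vector, which is then averaged over the law `ν` of the reward vector. -/
structure IsAlmostSupermartingale (k : ℕ) (μ δ : ℝ) (T : ℕ) (ν : Measure (Fin k → ℝ))
    (c : ℝ) (M : (n : ℕ) → (ℕ → Fin k → ℝ) → (Fin n → Fin k × Fin k) → ℝ) : Prop where
  nonneg : ∀ n g h, 0 ≤ M n g h
  meas : ∀ n h, Measurable fun g => M n g h
  step : ∀ n g h, HasAffineBound ν (fun y =>
    ∑ i, ∑ j, pVec k μ δ T (weight k μ δ T g n h) i * qVec k μ δ T (weight k μ δ T g n h) j *
        M (n + 1) (Function.update g n y) (snocHist h (i, j))) (M n g h + c)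

variable {ν : Measure (Fin k → ℝ)}

lemma HasAffineBound.mono {f f' : (Fin k → ℝ) → ℝ} {v v' : ℝ} (hf : HasAffineBound ν f v)
    (hff' : ∀ y : Fin k → ℝ, (∀ i, y i ∈ Set.Icc (0 : ℝ) 1) → f' y ≤ f y) (hv : v ≤ v') :
    HasAffineBound ν f' v' := by
  obtain ⟨a₀, a, h1, h2⟩ := hf
  exact ⟨a₀, a, fun y hy => (hff' y hy).trans (h1 y hy), h2.trans hv⟩

lemma HasAffineBound.const (v : ℝ) : HasAffineBound ν (fun _ => v) v :=
  ⟨v, 0, by simp, by simp⟩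

lemma HasAffineBound.add {f f' : (Fin k → ℝ) → ℝ} {v v' : ℝ} (hf : HasAffineBound ν f v)
    (hf' : HasAffineBound ν f' v') : HasAffineBound ν (fun y => f y + f' y) (v + v') := by
  obtain ⟨a₀, a, h1, h2⟩ := hf
  obtain ⟨b₀, b, h3, h4⟩ := hf'
  refine ⟨a₀ + b₀, fun l => a l + b l, fun y hy => ?_, ?_⟩
  · have := add_le_add (h1 y hy) (h3 y hy)
    simp only [add_mul, Finset.sum_add_distrib]
    linarith
  · simp only [add_mul, Finset.sum_add_distrib]
    linarith

lemma HasAffineBound.sum {ι : Type*} (s : Finset ι) {f : ι → (Fin k → ℝ) → ℝ} {v : ι → ℝ}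
    (hf : ∀ i ∈ s, HasAffineBound ν (f i) (v i)) :
    HasAffineBound ν (fun y => ∑ i ∈ s, f i y) (∑ i ∈ s, v i) := by
  classical
  induction s using Finset.induction_on with
  | empty => simpa using HasAffineBound.const (ν := ν) 0
  | insert i s hi ih =>
    simp only [Finset.sum_insert hi]
    exact (hf i (Finset.mem_insert_self i s)).add
      (ih fun j hj => hf j (Finset.mem_insert_of_mem hj))

lemma IsAlmostSupermartingale.add {c c' : ℝ}
    {M M' : (n : ℕ) → (ℕ → Fin k → ℝ) → (Fin n → Fin k × Fin k) → ℝ}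
    (hM : IsAlmostSupermartingale k μ δ T ν c M)
    (hM' : IsAlmostSupermartingale k μ δ T ν c' M') :
    IsAlmostSupermartingale k μ δ T ν (c + c') fun n g h => M n g h + M' n g h where
  nonneg n g h := add_nonneg (hM.nonneg n g h) (hM'.nonneg n g h)
  meas n h := (hM.meas n h).add (hM'.meas n h)
  step n g h := by
    refine ((hM.step n g h).add (hM'.step n g h)).mono (fun y _ => le_of_eq ?_) (by linarith)
    simp only [mul_add, Finset.sum_add_distrib]

lemma IsAlmostSupermartingale.zero :
    IsAlmostSupermartingale k μ δ T ν 0 fun _ _ _ => 0 where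
  nonneg _ _ _ := le_rfl
  meas _ _ := measurable_const
  step _ _ _ := by simpa using HasAffineBound.const 0

lemma IsAlmostSupermartingale.sum {ι : Type*} (s : Finset ι) {c : ι → ℝ}
    {M : ι → (n : ℕ) → (ℕ → Fin k → ℝ) → (Fin n → Fin k × Fin k) → ℝ}
    (hM : ∀ i ∈ s, IsAlmostSupermartingale k μ δ T ν (c i) (M i)) :
    IsAlmostSupermartingale k μ δ T ν (∑ i ∈ s, c i) fun n g h => ∑ i ∈ s, M i n g h := by
  classical
  induction s using Finset.induction_on with
  | empty => simpa using IsAlmostSupermartingale.zero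
  | insert i s hi ih =>
    simp only [Finset.sum_insert hi]
    exact (hM i (Finset.mem_insert_self i s)).add
      (ih fun j hj => hM j (Finset.mem_insert_of_mem hj))

variable [IsProbabilityMeasure ν]

lemma integrable_coord (hν : ∀ᵐ x ∂ν, ∀ i, x i ∈ Set.Icc (0 : ℝ) 1) (l : Fin k) :
    Integrable (fun x : Fin k → ℝ => x l) ν :=
  Integrable.of_bound (measurable_pi_apply l).aestronglyMeasurable 1 (by
    filter_upwards [hν] with x hx
    rw [Real.norm_eq_abs, abs_le]
    exact ⟨by linarith [(hx l).1], (hx l).2⟩)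

/-- The one-round expectation is dominated on the cube by an affine function, whose integral depends
on `ν` only through the means of the coordinates. -/
lemma IsAlmostSupermartingale.lintegral_step (hν : ∀ᵐ x ∂ν, ∀ i, x i ∈ Set.Icc (0 : ℝ) 1)
    {c : ℝ} (hc : 0 ≤ c) {M : (n : ℕ) → (ℕ → Fin k → ℝ) → (Fin n → Fin k × Fin k) → ℝ}
    (hM : IsAlmostSupermartingale k μ δ T ν c M)
    (n : ℕ) (g : ℕ → Fin k → ℝ) (h : Fin n → Fin k × Fin k) :
    ∫⁻ y, ∑ i, ∑ j, ENNReal.ofReal (pVec k μ δ T (weight k μ δ T g n h) i) *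
        ENNReal.ofReal (qVec k μ δ T (weight k μ δ T g n h) j) *
        ENNReal.ofReal (M (n + 1) (Function.update g n y) (snocHist h (i, j))) ∂ν ≤
      ENNReal.ofReal (M n g h) + ENNReal.ofReal c := by
  obtain ⟨a₀, a, h1, h2⟩ := hM.step n g h
  have hp := pVec_nonneg (μ := μ) (δ := δ) (T := T) (weight_pos (μ := μ) (δ := δ) (T := T) g n h)
  have hq := qVec_nonneg (μ := μ) (δ := δ) (T := T) (weight k μ δ T g n h)
  have hsum : ∀ y : Fin k → ℝ, ∑ i, ∑ j, ENNReal.ofReal (pVec k μ δ T (weight k μ δ T g n h) i) *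
        ENNReal.ofReal (qVec k μ δ T (weight k μ δ T g n h) j) *
        ENNReal.ofReal (M (n + 1) (Function.update g n y) (snocHist h (i, j))) =
      ENNReal.ofReal (∑ i, ∑ j, pVec k μ δ T (weight k μ δ T g n h) i *
        qVec k μ δ T (weight k μ δ T g n h) j *
        M (n + 1) (Function.update g n y) (snocHist h (i, j))) := by
    intro y
    have h0 : ∀ i j, 0 ≤ pVec k μ δ T (weight k μ δ T g n h) i *
        qVec k μ δ T (weight k μ δ T g n h) j *
        M (n + 1) (Function.update g n y) (snocHist h (i, j)) := fun i j =>
      mul_nonneg (mul_nonneg (hp i) (hq j)) (hM.nonneg _ _ _)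
    rw [ENNReal.ofReal_sum_of_nonneg fun i _ => Finset.sum_nonneg fun j _ => h0 i j]
    refine Finset.sum_congr rfl fun i _ => ?_
    rw [ENNReal.ofReal_sum_of_nonneg fun j _ => h0 i j]
    refine Finset.sum_congr rfl fun j _ => ?_
    rw [ENNReal.ofReal_mul (mul_nonneg (hp i) (hq j)), ENNReal.ofReal_mul (hp i)]
  simp only [hsum]
  have hint : Integrable (fun y : Fin k → ℝ => a₀ + ∑ l, a l * y l) ν :=
    (integrable_const _).add
      (integrable_finsetSum _ fun l _ => (integrable_coord hν l).const_mul _)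
  have hnn : 0 ≤ᵐ[ν] fun y : Fin k → ℝ => a₀ + ∑ l, a l * y l := by
    filter_upwards [hν] with y hy
    refine le_trans (Finset.sum_nonneg fun i _ => Finset.sum_nonneg fun j _ => ?_) (h1 y hy)
    exact mul_nonneg (mul_nonneg (hp i) (hq j)) (hM.nonneg _ _ _)
  calc _ ≤ ∫⁻ y, ENNReal.ofReal (a₀ + ∑ l, a l * y l) ∂ν := by
        refine lintegral_mono_ae ?_
        filter_upwards [hν] with y hy
        exact ENNReal.ofReal_le_ofReal (h1 y hy)
    _ = ENNReal.ofReal (∫ y, (a₀ + ∑ l, a l * y l) ∂ν) :=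
        (ofReal_integral_eq_lintegral_ofReal hint hnn).symm
    _ = ENNReal.ofReal (a₀ + ∑ l, a l * ∫ x, x l ∂ν) := by
        rw [integral_add (integrable_const _)
          (integrable_finsetSum _ fun l _ => (integrable_coord hν l).const_mul _),
          integral_finsetSum _ fun l _ => (integrable_coord hν l).const_mul _]
        simp [integral_const_mul]
    _ ≤ ENNReal.ofReal (M n g h + c) := ENNReal.ofReal_le_ofReal h2
    _ = _ := ENNReal.ofReal_add (hM.nonneg _ _ _) hc

lemma lintegral_pi_snoc (n : ℕ) {f : (Fin (n + 1) → Fin k → ℝ) → ENNReal} (hf : Measurable f) :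
    ∫⁻ x, f x ∂(Measure.pi fun _ : Fin (n + 1) => ν) =
      ∫⁻ x, ∫⁻ y, f (Fin.snoc (α := fun _ => Fin k → ℝ) x y) ∂ν
        ∂(Measure.pi fun _ : Fin n => ν) := by
  have e := (measurePreserving_piFinSuccAbove (fun _ : Fin (n + 1) => ν) (Fin.last n)).symm
  rw [← e.lintegral_comp hf, lintegral_prod_symm']
  · simp [MeasurableEquiv.piFinSuccAbove, Fin.insertNthEquiv, Fin.insertNth_last']
  · exact hf.comp (MeasurableEquiv.measurable _)

end Supermartingale

/-! ### The law of the history and the growth of expectations -/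

section Run

variable [NeZero k]

lemma run_snoc (g : ℕ → Fin k → ℝ) (n : ℕ) (h : Fin n → Fin k × Fin k) (i j : Fin k) :
    run k μ δ T g (n + 1) (snocHist h (i, j)) =
      run k μ δ T g n h * (ENNReal.ofReal (pVec k μ δ T (weight k μ δ T g n h) i) *
        ENNReal.ofReal (qVec k μ δ T (weight k μ δ T g n h) j)) := by
  have key : ∀ (h' : Fin n → Fin k × Fin k) (i' j' : Fin k),
      (snocHist h (i, j) = snocHist h' (i', j')) ↔ (h = h' ∧ i = i' ∧ j = j') := by
    intro h' i' j'
    rw [snocHist, snocHist, Fin.snoc_inj, Prod.mk.injEq]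
  rw [run]
  simp only [PMF.bind_apply, PMF.pure_apply]
  simp only [tsum_fintype, choosePMF, queryPMF, PMF.ofFintype_apply]
  rw [Finset.sum_eq_single h, Finset.sum_eq_single i, Finset.sum_eq_single j]
  · simp
  · intro j' _ hj
    rw [if_neg, mul_zero]
    rw [key]
    exact fun H => hj H.2.2.symm
  · simp
  · intro i' _ hi
    rw [Finset.sum_eq_zero, mul_zero]
    intro j' _
    rw [if_neg, mul_zero]
    rw [key]
    exact fun H => hi H.2.1.symm
  · simp
  · intro h' _ hh
    rw [Finset.sum_eq_zero, mul_zero]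
    intro i' _
    rw [Finset.sum_eq_zero, mul_zero]
    intro j' _
    rw [if_neg, mul_zero]
    rw [key]
    exact fun H => hh H.1.symm
  · simp

lemma run_congr {g g' : ℕ → Fin k → ℝ} {n : ℕ} (hg : ∀ t < n, g t = g' t) :
    run k μ δ T g n = run k μ δ T g' n := by
  induction n with
  | zero => rfl
  | succ n ih =>
    have hw : ∀ h : Fin n → Fin k × Fin k, weight k μ δ T g n h = weight k μ δ T g' n h :=
      weight_congr fun t ht => hg t (by omega)
    simp only [run, ih fun t ht => hg t (by omega), choosePMF, queryPMF, hw]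

lemma measurable_run (n : ℕ) (h : Fin n → Fin k × Fin k) :
    Measurable fun g : ℕ → Fin k → ℝ => run k μ δ T g n h := by
  induction n with
  | zero => exact measurable_const
  | succ n ih =>
    obtain ⟨h', a, rfl⟩ : ∃ h' a, snocHist h' a = h := ⟨Fin.init h, h (Fin.last n), by
      simp [snocHist, Fin.snoc_init_self]⟩
    obtain ⟨i, j⟩ := a
    simp only [run_snoc]
    exact (ih h').mul
      (((measurable_pVec i).comp (measurable_weight n h')).ennreal_ofReal.mul
        ((measurable_qVec j).comp (measurable_weight n h')).ennreal_ofReal)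

variable {ν : Measure (Fin k → ℝ)} [IsProbabilityMeasure ν]

/-- Induction on the rounds. By Fubini the newest reward vector is integrated first; the weights and
the law of the earlier history do not depend on it, so the one-round estimate applies for each fixed
past. -/
lemma IsAlmostSupermartingale.lintegral_run_le (hν : ∀ᵐ x ∂ν, ∀ i, x i ∈ Set.Icc (0 : ℝ) 1)
    {c : ℝ} (hc : 0 ≤ c) {M : (n : ℕ) → (ℕ → Fin k → ℝ) → (Fin n → Fin k × Fin k) → ℝ}
    (hM : IsAlmostSupermartingale k μ δ T ν c M) (n : ℕ) :
    ∫⁻ x, ∑ h, run k μ δ T (extendZero x) n h * ENNReal.ofReal (M n (extendZero x) h)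
        ∂(Measure.pi fun _ : Fin n => ν) ≤
      ENNReal.ofReal (M 0 0 Fin.elim0) + n * ENNReal.ofReal c := by
  induction n with
  | zero =>
    have h0 : ∀ x : Fin 0 → Fin k → ℝ, extendZero x = 0 := by
      intro x; funext t; simp [extendZero]
    have h1 : ∀ h : Fin 0 → Fin k × Fin k, h = Fin.elim0 := fun h => Subsingleton.elim _ _
    simp only [h0]
    rw [Fintype.sum_subsingleton _ (Fin.elim0 : Fin 0 → Fin k × Fin k)]
    simp [run]
  | succ n ih =>
    rw [lintegral_pi_snoc]
    swap
    · refine Finset.measurable_sum _ fun h _ => ?_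
      exact ((measurable_run _ h).comp (measurable_extendZero _)).mul
        ((hM.meas _ h).comp (measurable_extendZero _)).ennreal_ofReal
    have hstep : ∀ x : Fin n → Fin k → ℝ,
        ∫⁻ y, ∑ h, run k μ δ T (extendZero (Fin.snoc (α := fun _ => Fin k → ℝ) x y)) (n + 1) h *
          ENNReal.ofReal (M (n + 1)
            (extendZero (Fin.snoc (α := fun _ => Fin k → ℝ) x y)) h) ∂ν ≤
        (∑ h, run k μ δ T (extendZero x) n h * ENNReal.ofReal (M n (extendZero x) h)) +
          ENNReal.ofReal c := by
      intro x
      simp only [extendZero_snoc]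
      have hrw : ∀ y : Fin k → ℝ,
          ∑ h, run k μ δ T (Function.update (extendZero x) n y) (n + 1) h *
            ENNReal.ofReal (M (n + 1) (Function.update (extendZero x) n y) h) =
          ∑ h, run k μ δ T (extendZero x) n h * ∑ i, ∑ j,
            ENNReal.ofReal (pVec k μ δ T (weight k μ δ T (extendZero x) n h) i) *
            ENNReal.ofReal (qVec k μ δ T (weight k μ δ T (extendZero x) n h) j) *
            ENNReal.ofReal (M (n + 1) (Function.update (extendZero x) n y)
              (snocHist h (i, j))) := by
        intro y
        rw [sum_snocHist]
        refine Finset.sum_congr rfl fun h _ => ?_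
        simp only [Finset.mul_sum]
        refine Finset.sum_congr rfl fun i _ => Finset.sum_congr rfl fun j _ => ?_
        rw [run_snoc, weight_update, run_congr (g := Function.update (extendZero x) n y)
          (g' := extendZero x) fun t ht => by rw [Function.update_of_ne (by omega)]]
        ring
      have hupd : Measurable fun y : Fin k → ℝ => Function.update (extendZero x) n y :=
        measurable_update _
      have hmeas : ∀ h : Fin n → Fin k × Fin k, Measurable fun y : Fin k → ℝ => ∑ i, ∑ j,
            ENNReal.ofReal (pVec k μ δ T (weight k μ δ T (extendZero x) n h) i) *
            ENNReal.ofReal (qVec k μ δ T (weight k μ δ T (extendZero x) n h) j) *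
            ENNReal.ofReal (M (n + 1) (Function.update (extendZero x) n y)
              (snocHist h (i, j))) := fun h =>
        Finset.measurable_sum _ fun i _ => Finset.measurable_sum _ fun j _ =>
          ((hM.meas _ _).comp hupd).ennreal_ofReal.const_mul _
      simp only [hrw]
      rw [lintegral_finsetSum _ fun h _ => (hmeas h).const_mul _]
      calc _ ≤ ∑ h, run k μ δ T (extendZero x) n h *
              (ENNReal.ofReal (M n (extendZero x) h) + ENNReal.ofReal c) := by
            refine Finset.sum_le_sum fun h _ => ?_
            rw [lintegral_const_mul _ (hmeas h)]
            gcongr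
            exact hM.lintegral_step hν hc n _ h
        _ = _ := by
            simp only [mul_add, Finset.sum_add_distrib, ← Finset.sum_mul]
            rw [← tsum_fintype (L := .unconditional _) (f := run k μ δ T (extendZero x) n),
              PMF.tsum_coe, one_mul]
    calc _ ≤ _ := lintegral_mono hstep
      _ ≤ _ := by
        rw [lintegral_add_right _ measurable_const, lintegral_const, measure_univ, mul_one]
        calc _ ≤ _ := add_le_add ih le_rfl
          _ = _ := by push_cast; ring

end Run

end Histories

/-! ### One-round estimates for the sampling probabilities -/

section Probabilities

variable {k : ℕ} {μ δ : ℝ} {T : ℕ}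

/-- No lower bound on x is needed. This matters because importance weighting can make the exponents
very negative. -/
lemma exp_le_one_add_add_sq {x : ℝ} (hx : x ≤ 1) : Real.exp x ≤ 1 + x + x ^ 2 := by
  rcases le_total (-1) x with h | h
  · have := Real.abs_exp_sub_one_sub_id_le (abs_le.2 ⟨h, hx⟩)
    linarith [(abs_le.1 this).2]
  · have : Real.exp x ≤ 1 := Real.exp_le_one_iff.2 (by linarith)
    nlinarith

lemma sqrt_add_le_sqrt_add_sqrt {x y : ℝ} (hx : 0 ≤ x) (hy : 0 ≤ y) : √(x + y) ≤ √x + √y := by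
  refine Real.sqrt_le_iff.2 ⟨by positivity, ?_⟩
  nlinarith [Real.sq_sqrt hx, Real.sq_sqrt hy, mul_nonneg (Real.sqrt_nonneg x) (Real.sqrt_nonneg y)]

/-- The square root of the `ℓ^{1/2}` quasinorm of the exploitation probabilities. -/
def sqrtMass (k : ℕ) (μ δ : ℝ) (T : ℕ) (w : Fin k → ℝ) : ℝ := ∑ l, √(pVec k μ δ T w l)

lemma qVec_eq (w : Fin k → ℝ) (j : Fin k) :
    qVec k μ δ T w j = √(pVec k μ δ T w j) / sqrtMass k μ δ T w := rfl

lemma measurable_sqrtMass : Measurable fun w : Fin k → ℝ => sqrtMass k μ δ T w :=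
  Finset.measurable_sum _ fun l _ => (measurable_pVec l).sqrt

lemma one_sub_gamma_mul_le_pVec (w : Fin k → ℝ) (j : Fin k) :
    (1 - gamma k μ δ T) * (w j / ∑ l, w l) ≤ pVec k μ δ T w j := by
  unfold pVec
  have : 0 ≤ gamma k μ δ T / k := div_nonneg gamma_nonneg (Nat.cast_nonneg k)
  linarith

lemma nextWeight_pos {w : Fin k → ℝ} (hw : ∀ j, 0 < w j) (y : Fin k → ℝ) (J j : Fin k) :
    0 < nextWeight k μ δ T w y J j := mul_pos (hw j) (Real.exp_pos _)

variable [NeZero k]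

lemma cast_pos_of_neZero : 0 < (k : ℝ) := Nat.cast_pos.2 (NeZero.pos k)

lemma one_le_cast_of_neZero : 1 ≤ (k : ℝ) := by exact_mod_cast NeZero.one_le

variable {w : Fin k → ℝ}

lemma sum_weight_pos (hw : ∀ j, 0 < w j) : 0 < ∑ l, w l :=
  Finset.sum_pos (fun l _ => hw l) ⟨0, Finset.mem_univ _⟩

lemma gamma_div_le_pVec (hw : ∀ j, 0 < w j) (j : Fin k) :
    gamma k μ δ T / k ≤ pVec k μ δ T w j := by
  unfold pVec
  have := mul_nonneg (sub_nonneg.2 (gamma_le_one (k := k) (μ := μ) (δ := δ) (T := T)))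
    (div_nonneg (hw j).le (sum_weight_pos hw).le)
  linarith

lemma pVec_pos (hw : ∀ j, 0 < w j) (j : Fin k) : 0 < pVec k μ δ T w j := by
  rcases (gamma_nonneg (k := k) (μ := μ) (δ := δ) (T := T)).lt_or_eq with h | h
  · exact (div_pos h cast_pos_of_neZero).trans_le (gamma_div_le_pVec hw j)
  · refine lt_of_lt_of_le ?_ (one_sub_gamma_mul_le_pVec w j)
    rw [← h, sub_zero, one_mul]
    exact div_pos (hw j) (sum_weight_pos hw)

lemma pVec_le_one (hw : ∀ j, 0 < w j) (j : Fin k) : pVec k μ δ T w j ≤ 1 := by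
  rw [← pVec_sum (μ := μ) (δ := δ) (T := T) hw]
  exact Finset.single_le_sum (fun l _ => pVec_nonneg hw l) (Finset.mem_univ j)

lemma one_le_sqrtMass (hw : ∀ j, 0 < w j) : 1 ≤ sqrtMass k μ δ T w := by
  rw [← pVec_sum (μ := μ) (δ := δ) (T := T) hw]
  refine Finset.sum_le_sum fun l _ => Real.le_sqrt_of_sq_le ?_
  have h0 := pVec_nonneg (μ := μ) (δ := δ) (T := T) hw l
  nlinarith [pVec_le_one (μ := μ) (δ := δ) (T := T) hw l]

lemma sqrtMass_pos (hw : ∀ j, 0 < w j) : 0 < sqrtMass k μ δ T w :=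
  zero_lt_one.trans_le (one_le_sqrtMass hw)

lemma sqrtMass_sq_le (hw : ∀ j, 0 < w j) : sqrtMass k μ δ T w ^ 2 ≤ k := by
  have h := sq_sum_le_card_mul_sum_sq (s := Finset.univ)
    (f := fun l : Fin k => √(pVec k μ δ T w l))
  simp only [Real.sq_sqrt (pVec_nonneg hw _), pVec_sum hw, Finset.card_univ, Fintype.card_fin,
    mul_one] at h
  exact h

lemma qVec_pos (hw : ∀ j, 0 < w j) (j : Fin k) : 0 < qVec k μ δ T w j :=
  div_pos (Real.sqrt_pos.2 (pVec_pos hw j)) (sqrtMass_pos hw)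

lemma qVec_le_one (hw : ∀ j, 0 < w j) (j : Fin k) : qVec k μ δ T w j ≤ 1 := by
  rw [← qVec_sum (μ := μ) (δ := δ) (T := T) hw]
  exact Finset.single_le_sum (fun l _ => qVec_nonneg w l) (Finset.mem_univ j)

lemma pVec_div_qVec (hw : ∀ j, 0 < w j) (j : Fin k) :
    pVec k μ δ T w j / qVec k μ δ T w j = √(pVec k μ δ T w j) * sqrtMass k μ δ T w := by
  have h1 := Real.sqrt_pos.2 (pVec_pos (μ := μ) (δ := δ) (T := T) hw j)
  have h2 := sqrtMass_pos (μ := μ) (δ := δ) (T := T) hw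
  rw [qVec_eq, div_div_eq_mul_div, div_eq_iff h1.ne']
  linear_combination (-sqrtMass k μ δ T w) *
    Real.mul_self_sqrt (pVec_nonneg (μ := μ) (δ := δ) (T := T) hw j)

/-- Independence of j is what q ∝ √p buys: the second-order term costs the same whichever arm is
queried. -/
lemma pVec_div_qVec_sq (hw : ∀ j, 0 < w j) (j : Fin k) :
    pVec k μ δ T w j / qVec k μ δ T w j ^ 2 = sqrtMass k μ δ T w ^ 2 := by
  have h1 := Real.sqrt_pos.2 (pVec_pos (μ := μ) (δ := δ) (T := T) hw j)
  have h2 := sqrtMass_pos (μ := μ) (δ := δ) (T := T) hw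
  rw [qVec_eq, div_pow, Real.sq_sqrt (pVec_nonneg hw j)]
  have := (pVec_pos (μ := μ) (δ := δ) (T := T) hw j).ne'
  field_simp

/-- By Cauchy–Schwarz this is the smallest value that the sum can take over all query distributions.
-/
lemma sum_pVec_div_qVec (hw : ∀ j, 0 < w j) :
    ∑ j, pVec k μ δ T w j / qVec k μ δ T w j = sqrtMass k μ δ T w ^ 2 := by
  simp only [pVec_div_qVec hw, ← Finset.sum_mul]
  rw [sq]; rfl

/-- The mixing term keeps the step sizes bounded. -/
lemma eta_mul_div_qVec_le_one (hw : ∀ j, 0 < w j) (hη : 0 < eta μ T) (hβ : 0 ≤ beta k μ δ T)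
    (hγ : gamma k μ δ T < 1) (j : Fin k) :
    eta μ T * ((1 + beta k μ δ T) / qVec k μ δ T w j) ≤ 1 := by
  have hk := cast_pos_of_neZero (k := k)
  -- γ < 1 means that the cap is inactive; then √(γ/k) = η(1+β)√k, which matches S ≤ √k.
  have hg : gamma k μ δ T = (eta μ T * (1 + beta k μ δ T) * k) ^ 2 := by
    rw [gamma, min_eq_right_iff.2, mul_pow, mul_pow]
    by_contra! hcon
    rw [gamma, min_eq_left hcon.le] at hγ
    exact lt_irrefl _ hγ
  have h0 : 0 ≤ eta μ T * (1 + beta k μ δ T) := by positivity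
  have h1 : eta μ T * (1 + beta k μ δ T) * √k ≤ √(pVec k μ δ T w j) := by
    refine Real.le_sqrt_of_sq_le (le_trans (le_of_eq ?_) (gamma_div_le_pVec hw j))
    rw [hg, mul_pow, Real.sq_sqrt hk.le]
    field_simp
  have h2 : sqrtMass k μ δ T w ≤ √k := Real.le_sqrt_of_sq_le (sqrtMass_sq_le hw)
  rw [← mul_div_assoc, div_le_one (qVec_pos hw j), qVec_eq, le_div_iff₀ (sqrtMass_pos hw)]
  exact (mul_le_mul_of_nonneg_left h2 h0).trans h1

/-- Subadditivity of the square root separates the weights from the mixing, whose k terms √(γ/k) add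
up to √(kγ). The normalisation V will be the total weight of G. -/
lemma sqrtMass_le_add (hw : ∀ j, 0 < w j) {V : ℝ} (hV : 0 < V) (hVW : V ≤ ∑ l, w l) :
    sqrtMass k μ δ T w ≤ ∑ l, √(w l / V) + √(k * gamma k μ δ T) := by
  have hk := cast_pos_of_neZero (k := k)
  have hg0 := gamma_nonneg (k := k) (μ := μ) (δ := δ) (T := T)
  have h1 : ∀ l, √(pVec k μ δ T w l) ≤ √(w l / V) + √(gamma k μ δ T / k) := by
    intro l
    have hb : (1 - gamma k μ δ T) * (w l / ∑ l, w l) ≤ w l / V := by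
      refine (mul_le_of_le_one_left (div_nonneg (hw l).le (sum_weight_pos hw).le)
        (by linarith)).trans ?_
      exact div_le_div_of_nonneg_left (hw l).le hV hVW
    have ha : 0 ≤ w l / V := div_nonneg (hw l).le hV.le
    refine (Real.sqrt_le_sqrt (add_le_add_left hb _)).trans ?_
    exact sqrt_add_le_sqrt_add_sqrt ha (by positivity)
  refine (Finset.sum_le_sum fun l _ => h1 l).trans (le_of_eq ?_)
  rw [Finset.sum_add_distrib]
  simp only [Finset.sum_const, Finset.card_univ, Fintype.card_fin, nsmul_eq_mul]
  congr 1
  rw [← Real.sqrt_sq hk.le, ← Real.sqrt_mul (sq_nonneg _), Real.sqrt_sq hk.le]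
  congr 1
  field_simp

lemma sqrtMass_sq_le_add (hw : ∀ j, 0 < w j) {V : ℝ} (hV : 0 < V) (hVW : V ≤ ∑ l, w l) :
    sqrtMass k μ δ T w ^ 2 ≤ 2 * (∑ l, √(w l / V)) ^ 2 + 2 * (k * gamma k μ δ T) := by
  have h := sqrtMass_le_add (μ := μ) (δ := δ) (T := T) hw hV hVW
  have h0 := sqrtMass_pos (μ := μ) (δ := δ) (T := T) hw
  have h1 : √(k * gamma k μ δ T) ^ 2 = k * gamma k μ δ T :=
    Real.sq_sqrt (mul_nonneg cast_pos_of_neZero.le gamma_nonneg)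
  nlinarith [sq_nonneg (∑ l, √(w l / V) - √(k * gamma k μ δ T))]

/-- An arm is queried with probability of order at least `1 / k` unless its weight is small
compared with the other weights. -/
lemma one_div_qVec_le (hw : ∀ j, 0 < w j) {V : ℝ} (hV : 0 < V) (j : Fin k) :
    1 / qVec k μ δ T w j ≤ k + (∑ l, √(w l / V)) / √(w j / V) := by
  have hk := cast_pos_of_neZero (k := k)
  have hW := sum_weight_pos hw
  have hg0 := gamma_nonneg (k := k) (μ := μ) (δ := δ) (T := T)
  have hg1 := sub_nonneg.2 (gamma_le_one (k := k) (μ := μ) (δ := δ) (T := T))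
  set γ := gamma k μ δ T with hγ
  have hp := Real.sqrt_pos.2 (pVec_pos (μ := μ) (δ := δ) (T := T) hw j)
  have hj : 0 < √(w j / V) := Real.sqrt_pos.2 (div_pos (hw j) hV)
  -- The factor that passes from normalisation by V to the unmixed part of p. It cancels in S/√p_j
  -- because √p_j ≥ c√(w_j/V); the mixing part of S is at most k√p_j.
  set c := √((1 - γ) * V / ∑ l, w l) with hc
  have hc0 : 0 ≤ c := Real.sqrt_nonneg _
  have hcl : ∀ l, √((1 - γ) * (w l / ∑ l, w l)) = c * √(w l / V) := by
    intro l
    rw [hc, ← Real.sqrt_mul (div_nonneg (mul_nonneg hg1 hV.le) hW.le)]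
    congr 1
    field_simp
  have h1 : ∀ l, √(pVec k μ δ T w l) ≤ c * √(w l / V) + √(γ / k) := by
    intro l
    rw [← hcl]
    exact sqrt_add_le_sqrt_add_sqrt
      (mul_nonneg hg1 (div_nonneg (hw l).le hW.le)) (by positivity)
  have h2 : c * √(w j / V) ≤ √(pVec k μ δ T w j) := by
    rw [← hcl]
    exact Real.sqrt_le_sqrt (one_sub_gamma_mul_le_pVec w j)
  have h3 : √(γ / k) ≤ √(pVec k μ δ T w j) := Real.sqrt_le_sqrt (gamma_div_le_pVec hw j)
  have h4 : sqrtMass k μ δ T w ≤ c * ∑ l, √(w l / V) + k * √(γ / k) := by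
    refine (Finset.sum_le_sum fun l _ => h1 l).trans (le_of_eq ?_)
    rw [Finset.sum_add_distrib, Finset.mul_sum]
    simp
  have h5 : 0 ≤ ∑ l, √(w l / V) := Finset.sum_nonneg fun _ _ => Real.sqrt_nonneg _
  rw [qVec_eq, one_div_div, div_le_iff₀ hp]
  have h6 : c ≤ √(pVec k μ δ T w j) / √(w j / V) := (le_div_iff₀ hj).2 h2
  calc sqrtMass k μ δ T w ≤ c * ∑ l, √(w l / V) + k * √(γ / k) := h4
    _ ≤ √(pVec k μ δ T w j) / √(w j / V) * ∑ l, √(w l / V) + k * √(pVec k μ δ T w j) := by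
        gcongr
    _ = _ := by ring

lemma sum_qVec_ite (hw : ∀ j, 0 < w j) (i : Fin k) (a : ℝ) (f : ℝ → ℝ) :
    ∑ J, qVec k μ δ T w J * f (if J = i then a else 0) =
      qVec k μ δ T w i * f a + (1 - qVec k μ δ T w i) * f 0 := by
  have h := qVec_sum (μ := μ) (δ := δ) (T := T) hw
  rw [← Finset.add_sum_erase _ _ (Finset.mem_univ i)] at h ⊢
  rw [if_pos rfl]
  have : ∑ J ∈ Finset.univ.erase i, qVec k μ δ T w J * f (if J = i then a else 0) =
      (∑ J ∈ Finset.univ.erase i, qVec k μ δ T w J) * f 0 := by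
    rw [Finset.sum_mul]
    exact Finset.sum_congr rfl fun J hJ => by rw [if_neg (Finset.ne_of_mem_erase hJ)]
  rw [this, eq_sub_of_add_eq' h]

lemma sum_pVec_qVec (hw : ∀ j, 0 < w j) (f : Fin k → ℝ) :
    ∑ i, ∑ j, pVec k μ δ T w i * qVec k μ δ T w j * f j = ∑ j, qVec k μ δ T w j * f j := by
  simp only [mul_assoc, ← Finset.mul_sum, ← Finset.sum_mul, pVec_sum hw, one_mul]

/-- With the confidence width, the estimated gains of an arm are unlikely to be much smaller than
its true gains. -/
lemma sum_exp_div_nextWeight_le (hw : ∀ j, 0 < w j) (hη : 0 < eta μ T) (hη1 : eta μ T ≤ 1)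
    (hηβ : eta μ T ≤ beta k μ δ T) {y : Fin k → ℝ} (i : Fin k)
    (hy : y i ∈ Set.Icc (0 : ℝ) 1) :
    ∑ J, qVec k μ δ T w J * (Real.exp (eta μ T * y i) / nextWeight k μ δ T w y J i) ≤
      1 / w i := by
  have hq := qVec_pos (μ := μ) (δ := δ) (T := T) hw i
  have hq1 := qVec_le_one (μ := μ) (δ := δ) (T := T) hw i
  set q := qVec k μ δ T w i with hqd
  set e := eta μ T with he
  set b := beta k μ δ T with hb
  have hwi := hw i
  -- The confidence bonus does not depend on J and factors out as exp(-ηβ/q).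
  have h1 : ∀ J, Real.exp (e * y i) / nextWeight k μ δ T w y J i =
      Real.exp (e * (y i - (if J = i then y i else 0) / q)) * (Real.exp (-(e * b / q)) / w i) := by
    intro J
    rw [nextWeight, ← he, ← hb, ← hqd, div_eq_iff (by positivity)]
    have h2 : Real.exp (e * y i) = Real.exp (e * (y i - (if J = i then y i else 0) / q)) *
      Real.exp (-(e * b / q)) *
      Real.exp (e * (((if J = i then y i else 0) + b) / q)) := by
        rw [← Real.exp_add, ← Real.exp_add]
        congr 1
        ring
    rw [h2]
    field_simp
  simp only [h1]
  rw [sum_qVec_ite hw i (y i) fun z =>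
    Real.exp (e * (y i - z / q)) * (Real.exp (-(e * b / q)) / w i), ← hqd]
  have hx1 : e * (y i - y i / q) ≤ 1 := by
    have : y i ≤ y i / q := by
      rw [le_div_iff₀ hq]; nlinarith [hy.1]
    nlinarith
  have hx0 : e * (y i - 0 / q) ≤ 1 := by
    rw [zero_div, sub_zero]; nlinarith [hy.1, hy.2]
  -- The estimation error without the bonus is centred with second moment y²(1/q - 1). Since η ≤ β,
  -- the bonus ηβ/q pays for the resulting η²/q.
  have hE : q * Real.exp (e * (y i - y i / q)) + (1 - q) * Real.exp (e * (y i - 0 / q)) ≤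
      Real.exp (e * b / q) := by
    calc _ ≤ q * (1 + e * (y i - y i / q) + (e * (y i - y i / q)) ^ 2) +
          (1 - q) * (1 + e * (y i - 0 / q) + (e * (y i - 0 / q)) ^ 2) := by
          have := exp_le_one_add_add_sq hx1
          have := exp_le_one_add_add_sq hx0
          have : 0 ≤ 1 - q := by linarith
          gcongr
      _ = 1 + (e * y i) ^ 2 * (1 / q - 1) := by
          field_simp
          ring
      _ ≤ 1 + e * b / q := by
          have h3 : (e * y i) ^ 2 ≤ e * b := by
            have : y i ^ 2 ≤ 1 := by nlinarith [hy.1, hy.2]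
            rw [mul_pow]
            nlinarith [sq_nonneg e]
          have h4 : 0 ≤ 1 / q - 1 := by
            rw [sub_nonneg, le_div_iff₀ hq]; linarith
          have h5 : e * b / q = e * b * (1 / q) := by ring
          rw [h5]
          nlinarith [mul_nonneg (sq_nonneg (e * y i)) h4, sq_nonneg (e * y i)]
      _ ≤ _ := by linarith [Real.add_one_le_exp (e * b / q)]
  calc _ = (q * Real.exp (e * (y i - y i / q)) + (1 - q) * Real.exp (e * (y i - 0 / q))) *
        (Real.exp (-(e * b / q)) / w i) := by ring
    _ ≤ Real.exp (e * b / q) * (Real.exp (-(e * b / q)) / w i) := by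
        gcongr
    _ = 1 / w i := by
        rw [← mul_div_assoc, ← Real.exp_add]
        simp

/-- The importance weighted gain of the queried arm minus the gain of the chosen arm. -/
def gainDiff (k : ℕ) (μ δ : ℝ) (T : ℕ) (w y : Fin k → ℝ) (a : Fin k × Fin k) : ℝ :=
  pVec k μ δ T w a.2 / qVec k μ δ T w a.2 * y a.2 - y a.1

/-- Both the importance weighted gain and the collected gain have mean ∑ p_j y_j, so the difference
is centred. Since p_j/q_j = √p_j S ≤ S, its second moment is at most 2S + 2 ≤ 4S², and η times it is
at most ηk ≤ 1. -/
lemma sum_exp_gainDiff_le (hw : ∀ j, 0 < w j) (hη : 0 < eta μ T) (hη1 : eta μ T * k ≤ 1)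
    {y : Fin k → ℝ} (hy : ∀ i, y i ∈ Set.Icc (0 : ℝ) 1) :
    ∑ i, ∑ j, pVec k μ δ T w i * qVec k μ δ T w j *
      Real.exp (eta μ T * gainDiff k μ δ T w y (i, j) -
        4 * eta μ T ^ 2 * sqrtMass k μ δ T w ^ 2) ≤ 1 := by
  set e := eta μ T with he
  set S := sqrtMass k μ δ T w with hS
  have hS1 : 1 ≤ S := one_le_sqrtMass hw
  have hSk : S ≤ k := by
    have := sqrtMass_sq_le (μ := μ) (δ := δ) (T := T) hw
    rw [← hS] at this
    nlinarith
  have hp := pVec_pos (μ := μ) (δ := δ) (T := T) hw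
  have hq := qVec_pos (μ := μ) (δ := δ) (T := T) hw
  have hps := pVec_sum (μ := μ) (δ := δ) (T := T) hw
  have hqs := qVec_sum (μ := μ) (δ := δ) (T := T) hw
  set p := pVec k μ δ T w with hpd
  set q := qVec k μ δ T w with hqd
  have hr : ∀ j, p j / q j ≤ S := by
    intro j
    rw [hpd, hqd, pVec_div_qVec hw]
    have : √(pVec k μ δ T w j) ≤ 1 := Real.sqrt_le_one.2 (pVec_le_one hw j)
    nlinarith
  set D : Fin k → Fin k → ℝ := fun i j => gainDiff k μ δ T w y (i, j) with hD
  have hDdef : ∀ i j, D i j = p j / q j * y j - y i := fun i j => rfl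
  have hD1 : ∀ i j, e * D i j ≤ 1 := by
    intro i j
    have h0 : 0 ≤ p j / q j := (div_pos (hp j) (hq j)).le
    have : D i j ≤ k := by
      rw [hDdef]
      nlinarith [(hy i).1, (hy j).1, (hy j).2, hr j]
    nlinarith
  have hmean : ∑ i, ∑ j, p i * q j * D i j = 0 := by
    have : ∀ i j, p i * q j * D i j = p i * (p j * y j) - p i * y i * q j := by
      intro i j
      rw [hDdef]
      have := (hq j).ne'
      field_simp
    simp only [this, Finset.sum_sub_distrib, ← Finset.mul_sum, ← Finset.sum_mul, hps, hqs]
    ring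
  have hvar : ∑ i, ∑ j, p i * q j * D i j ^ 2 ≤ 4 * S ^ 2 := by
    have : ∀ i j, p i * q j * D i j ^ 2 ≤ p i * (2 * S * p j + 2 * q j) := by
      intro i j
      have h1 : D i j ^ 2 ≤ 2 * (p j / q j) ^ 2 + 2 := by
        rw [hDdef]
        have a1 : (p j / q j * y j) ^ 2 ≤ (p j / q j) ^ 2 := by
          rw [mul_pow]
          exact mul_le_of_le_one_right (sq_nonneg _) (by nlinarith [(hy j).1, (hy j).2])
        have a2 : y i ^ 2 ≤ 1 := by nlinarith [(hy i).1, (hy i).2]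
        nlinarith [sq_nonneg (p j / q j * y j + y i)]
      have h2 : q j * (p j / q j) ^ 2 ≤ S * p j := by
        have := (hq j).ne'
        have h3 : q j * (p j / q j) ^ 2 = p j / q j * p j := by field_simp
        rw [h3]
        exact mul_le_mul_of_nonneg_right (hr j) (hp j).le
      rw [mul_assoc]
      refine mul_le_mul_of_nonneg_left ?_ (hp i).le
      nlinarith [mul_le_mul_of_nonneg_left h1 (hq j).le]
    refine (Finset.sum_le_sum fun i _ => Finset.sum_le_sum fun j _ => this i j).trans ?_
    simp only [← Finset.mul_sum, ← Finset.sum_mul, Finset.sum_add_distrib, hps, hqs]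
    nlinarith
  have hone : ∑ i, ∑ j, p i * q j = 1 := by
    simp only [← Finset.mul_sum, hqs, mul_one, hps]
  have hmain : ∑ i, ∑ j, p i * q j * Real.exp (e * D i j) ≤ 1 + e ^ 2 * (4 * S ^ 2) := by
    calc _ ≤ ∑ i, ∑ j, p i * q j * (1 + e * D i j + (e * D i j) ^ 2) := by
          refine Finset.sum_le_sum fun i _ => Finset.sum_le_sum fun j _ => ?_
          exact mul_le_mul_of_nonneg_left (exp_le_one_add_add_sq (hD1 i j))
            (mul_pos (hp i) (hq j)).le
      _ = ∑ i, ∑ j, p i * q j + e * ∑ i, ∑ j, p i * q j * D i j +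
          e ^ 2 * ∑ i, ∑ j, p i * q j * D i j ^ 2 := by
          simp only [Finset.mul_sum, ← Finset.sum_add_distrib]
          refine Finset.sum_congr rfl fun i _ => Finset.sum_congr rfl fun j _ => ?_
          ring
      _ ≤ _ := by
          rw [hmean, hone, mul_zero, add_zero]
          gcongr
  calc _ = (∑ i, ∑ j, p i * q j * Real.exp (e * D i j)) * Real.exp (-(4 * e ^ 2 * S ^ 2)) := by
        simp only [Finset.sum_mul]
        refine Finset.sum_congr rfl fun i _ => Finset.sum_congr rfl fun j _ => ?_
        rw [sub_eq_add_neg, Real.exp_add, ← mul_assoc]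
    _ ≤ Real.exp (4 * e ^ 2 * S ^ 2) * Real.exp (-(4 * e ^ 2 * S ^ 2)) := by
        refine mul_le_mul_of_nonneg_right (hmain.trans ?_) (Real.exp_pos _).le
        linarith [Real.add_one_le_exp (4 * e ^ 2 * S ^ 2)]
    _ = 1 := by rw [← Real.exp_add]; simp

end Probabilities

/-! ### Drift of the log-weights of arms near the barrier -/

section Barrier

variable {k : ℕ} {μ δ : ℝ} {T : ℕ}

/-- The importance weighted gain estimate with its confidence bonus. -/
def gainEst (k : ℕ) (μ δ : ℝ) (T : ℕ) (w y : Fin k → ℝ) (J j : Fin k) : ℝ :=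
  ((if J = j then y j else 0) + beta k μ δ T) / qVec k μ δ T w j

lemma nextWeight_eq (w y : Fin k → ℝ) (J j : Fin k) :
    nextWeight k μ δ T w y J j = w j * Real.exp (eta μ T * gainEst k μ δ T w y J j) := rfl

/-- The total weight of the arms in `G`. -/
def massOn (G : Finset (Fin k)) (w : Fin k → ℝ) : ℝ := ∑ i ∈ G, w i

lemma massOn_pos {G : Finset (Fin k)} (hG : G.Nonempty) {w : Fin k → ℝ} (hw : ∀ j, 0 < w j) :
    0 < massOn G w := Finset.sum_pos (fun i _ => hw i) hG

lemma massOn_le {G : Finset (Fin k)} {w : Fin k → ℝ} (hw : ∀ j, 0 < w j) :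
    massOn G w ≤ ∑ l, w l :=
  Finset.sum_le_sum_of_subset_of_nonneg (Finset.subset_univ G) fun l _ _ => (hw l).le

lemma sum_sqrt_div_massOn_le {G : Finset (Fin k)} (hG : G.Nonempty) {w : Fin k → ℝ}
    (hw : ∀ j, 0 < w j) {B : ℝ} (hB : ∀ l ∉ G, w l ≤ B * massOn G w) :
    ∑ l, √(w l / massOn G w) ≤ G.card + k * √B := by
  classical
  have hV := massOn_pos hG hw
  rw [← Finset.sum_add_sum_compl G]
  refine add_le_add ?_ ?_
  · have : ∀ i ∈ G, √(w i / massOn G w) ≤ 1 := by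
      intro i hi
      rw [Real.sqrt_le_one, div_le_one hV]
      exact Finset.single_le_sum (fun l _ => (hw l).le) hi
    simpa using Finset.sum_le_sum this
  · have : ∀ i ∈ Gᶜ, √(w i / massOn G w) ≤ √B := by
      intro i hi
      refine Real.sqrt_le_sqrt ?_
      rw [div_le_iff₀ hV]
      exact hB i (Finset.mem_compl.1 hi)
    refine (Finset.sum_le_sum this).trans ?_
    rw [Finset.sum_const, nsmul_eq_mul]
    refine mul_le_mul_of_nonneg_right ?_ (Real.sqrt_nonneg _)
    exact_mod_cast (Finset.card_le_univ _).trans_eq (Fintype.card_fin k)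

variable [NeZero k] {w : Fin k → ℝ}

lemma sum_qVec_gainEst (hw : ∀ j, 0 < w j) (y : Fin k → ℝ) (i : Fin k) :
    ∑ J, qVec k μ δ T w J * gainEst k μ δ T w y J i =
      y i + beta k μ δ T / qVec k μ δ T w i := by
  unfold gainEst
  rw [sum_qVec_ite hw i (y i) fun z => (z + beta k μ δ T) / qVec k μ δ T w i]
  have := (qVec_pos (μ := μ) (δ := δ) (T := T) hw i).ne'
  field_simp
  ring

lemma sum_qVec_gainEst_sq_le (hw : ∀ j, 0 < w j) {y : Fin k → ℝ} (i : Fin k)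
    (hy : y i ∈ Set.Icc (0 : ℝ) 1) :
    ∑ J, qVec k μ δ T w J * gainEst k μ δ T w y J i ^ 2 ≤
      2 * (1 / qVec k μ δ T w i) +
        2 * beta k μ δ T ^ 2 * (1 / qVec k μ δ T w i) ^ 2 := by
  unfold gainEst
  rw [sum_qVec_ite hw i (y i) fun z => ((z + beta k μ δ T) / qVec k μ δ T w i) ^ 2]
  have hq := qVec_pos (μ := μ) (δ := δ) (T := T) hw i
  have hq1 := qVec_le_one (μ := μ) (δ := δ) (T := T) hw i
  set q := qVec k μ δ T w i
  set b := beta k μ δ T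
  have h1 : q * ((y i + b) / q) ^ 2 + (1 - q) * ((0 + b) / q) ^ 2 =
      (q * ((y i + b) ^ 2 - b ^ 2) + b ^ 2) / q ^ 2 := by
    field_simp
    ring
  have h2 : 2 * (1 / q) + 2 * b ^ 2 * (1 / q) ^ 2 = (2 * q + 2 * b ^ 2) / q ^ 2 := by
    field_simp
  rw [h1, h2]
  refine div_le_div_of_nonneg_right ?_ (sq_nonneg q)
  have h3 : (y i + b) ^ 2 - b ^ 2 ≤ 2 + b ^ 2 := by
    have : y i ^ 2 ≤ 1 := by nlinarith [hy.1, hy.2]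
    nlinarith [sq_nonneg (y i - b)]
  nlinarith [mul_le_mul_of_nonneg_left h3 hq.le, sq_nonneg b]

/-- The relative weight of j is at least B/25 while ∑ √(w_l/V) ≤ m + k√B, so `one_div_qVec_le` gives
k + 5m/√B + 5k. The bound B ≥ 1/k² turns 1/√B into k; this is why the barrier must not sink further.
-/
lemma one_div_qVec_le_of_near_barrier (hw : ∀ j, 0 < w j) {G : Finset (Fin k)} (hG : G.Nonempty)
    {B : ℝ} (hB0 : 1 / (k : ℝ) ^ 2 ≤ B) (halive : ∀ l ∉ G, w l ≤ B * massOn G w) {j : Fin k}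
    (hzone : B * massOn G w ≤ 25 * w j) :
    1 / qVec k μ δ T w j ≤ 11 * (G.card * k) := by
  have hk1 := one_le_cast_of_neZero (k := k)
  have hm1 : (1 : ℝ) ≤ G.card := by exact_mod_cast hG.card_pos
  have hV := massOn_pos hG hw
  have hSum := sum_sqrt_div_massOn_le hG hw halive
  have hqle := one_div_qVec_le (μ := μ) (δ := δ) (T := T) hw hV j
  have hk0 : (0 : ℝ) < k := by linarith
  have hBpos : 0 < B := lt_of_lt_of_le (by positivity) hB0
  have hb1 : 1 / (k : ℝ) ≤ √B := Real.le_sqrt_of_sq_le (by rw [div_pow, one_pow]; exact hB0)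
  have hbpos : 0 < √B := Real.sqrt_pos.2 hBpos
  have huj : √B / 5 ≤ √(w j / massOn G w) := by
    refine Real.le_sqrt_of_sq_le ?_
    rw [div_pow, Real.sq_sqrt hBpos.le, div_le_div_iff₀ (by norm_num) hV]
    linarith
  have h1 : (∑ l, √(w l / massOn G w)) / √(w j / massOn G w) ≤ (G.card + k * √B) / (√B / 5) :=
    div_le_div₀ (by positivity) hSum (by positivity) huj
  have h2 : (G.card + k * √B) / (√B / 5) = 5 * G.card * (1 / √B) + 5 * k := by
    field_simp
  have h3 : 1 / √B ≤ k := by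
    rw [div_le_iff₀ hbpos]
    rw [div_le_iff₀ hk0] at hb1
    linarith
  have h4 : 5 * G.card * (1 / √B) ≤ 5 * G.card * (k : ℝ) :=
    mul_le_mul_of_nonneg_left h3 (by linarith)
  have h5 : (k : ℝ) ≤ G.card * k := le_mul_of_one_le_left (by linarith) hm1
  linarith

/-- An arm of G may have a tiny weight and then 1/q_i is large, but its share u_i in G compensates:
√u_i/q_i ≤ √u_i k + ∑ √u_l ≤ mk + 3mk. -/
lemma mul_one_div_qVec_le_of_mem (hw : ∀ j, 0 < w j) {G : Finset (Fin k)} (hG : G.Nonempty)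
    {B : ℝ} (hB4 : B ≤ 4) (halive : ∀ l ∉ G, w l ≤ B * massOn G w) {i : Fin k} (hi : i ∈ G) :
    w i / massOn G w * (1 / qVec k μ δ T w i) ≤ 4 * (G.card * k) ∧
      w i / massOn G w * (1 / qVec k μ δ T w i) ^ 2 ≤ 20 * (G.card * k) ^ 2 := by
  have hk1 := one_le_cast_of_neZero (k := k)
  have hm1 : (1 : ℝ) ≤ G.card := by exact_mod_cast hG.card_pos
  have hV := massOn_pos hG hw
  have hSum := sum_sqrt_div_massOn_le hG hw halive
  have hqle := one_div_qVec_le (μ := μ) (δ := δ) (T := T) hw hV i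
  have hb2 : √B ≤ 2 := Real.sqrt_le_iff.2 ⟨by norm_num, by linarith⟩
  have h5 : (k : ℝ) ≤ G.card * k := le_mul_of_one_le_left (by linarith) hm1
  have h6 : (G.card : ℝ) ≤ G.card * k := le_mul_of_one_le_right (by linarith) hk1
  set m := (G.card : ℝ) with hm
  set K := (k : ℝ) with hK
  have hr0 : 0 ≤ w i / massOn G w := (div_pos (hw i) hV).le
  have hr1 : w i / massOn G w ≤ 1 := by
    rw [div_le_one hV]
    exact Finset.single_le_sum (fun l _ => (hw l).le) hi
  have hs0 : 0 < √(w i / massOn G w) := Real.sqrt_pos.2 (div_pos (hw i) hV)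
  have hs2 : √(w i / massOn G w) ^ 2 = w i / massOn G w := Real.sq_sqrt hr0
  have hs1 : √(w i / massOn G w) ≤ 1 := Real.sqrt_le_one.2 hr1
  have hq0 : 0 ≤ 1 / qVec k μ δ T w i := (one_div_pos.2 (qVec_pos hw i)).le
  set s := √(w i / massOn G w) with hs
  set Q := 1 / qVec k μ δ T w i
  have hsum3 : ∑ l, √(w l / massOn G w) ≤ 3 * (m * K) := by
    have := mul_le_mul_of_nonneg_left hb2 (by linarith : 0 ≤ K)
    linarith
  have h1 : s * Q ≤ s * K + 3 * (m * K) := by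
    have := mul_le_mul_of_nonneg_left hqle hs0.le
    rw [mul_add, mul_div_cancel₀ _ hs0.ne'] at this
    linarith
  have h2 : s * K ≤ m * K := mul_le_mul_of_nonneg_right (hs1.trans hm1) (by linarith)
  have h3 : 0 ≤ s * Q := mul_nonneg hs0.le hq0
  rw [← hs2]
  constructor
  · calc s ^ 2 * Q = s * (s * Q) := by ring
      _ ≤ 1 * (s * Q) := mul_le_mul_of_nonneg_right hs1 h3
      _ ≤ _ := by linarith
  · calc s ^ 2 * Q ^ 2 = (s * Q) ^ 2 := by rw [mul_pow]
      _ ≤ (4 * (m * K)) ^ 2 := pow_le_pow_left₀ h3 (by linarith) 2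
      _ ≤ _ := by nlinarith [sq_nonneg (m * K)]

set_option maxHeartbeats 1000000 in
/-- As long as all arms outside `G` are below the barrier `B`, the logarithm of the relative weight
of an arm that is close to the barrier has a negative drift and small exponential moments. -/
lemma sum_exp_drift_le (hw : ∀ j, 0 < w j) {G : Finset (Fin k)} (hG : G.Nonempty)
    {Δ B lam : ℝ} (hΔ1 : Δ ≤ 1) (hB0 : 1 / (k : ℝ) ^ 2 ≤ B) (hB4 : B ≤ 4)
    (hη : 0 < eta μ T) (hβ0 : 0 ≤ beta k μ δ T) (hβ : 44 * G.card * k * beta k μ δ T ≤ Δ)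
    (hlam : 0 < lam) (hlamη : 408 * (G.card : ℝ) ^ 2 * k * (lam * eta μ T) = Δ)
    (halive : ∀ l ∉ G, w l ≤ B * massOn G w) {j : Fin k}
    (hzone : B * massOn G w ≤ 25 * w j)
    {y : Fin k → ℝ} (hy : ∀ i, y i ∈ Set.Icc (0 : ℝ) 1) :
    ∑ J, qVec k μ δ T w J * Real.exp (lam * (eta μ T * gainEst k μ δ T w y J j -
        eta μ T * ∑ i ∈ G, w i / massOn G w * gainEst k μ δ T w y J i + eta μ T * Δ / 2)) ≤
      1 + lam * eta μ T * (y j - ∑ i ∈ G, w i / massOn G w * y i + Δ) := by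
  have hk1 := one_le_cast_of_neZero (k := k)
  have hm1 : (1 : ℝ) ≤ G.card := by exact_mod_cast hG.card_pos
  have hV := massOn_pos hG hw
  have hq := qVec_pos (μ := μ) (δ := δ) (T := T) hw
  have hqs := qVec_sum (μ := μ) (δ := δ) (T := T) hw
  have hqj := one_div_qVec_le_of_near_barrier (μ := μ) (δ := δ) (T := T) hw hG hB0 halive hzone
  have hrq := fun i hi =>
    mul_one_div_qVec_le_of_mem (μ := μ) (δ := δ) (T := T) hw hG hB4 halive (i := i) hi
  have hM1 : ∀ J, gainEst k μ δ T w y J j ≤ (1 + beta k μ δ T) * (1 / qVec k μ δ T w j) := by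
    intro J
    rw [gainEst, mul_one_div]
    refine div_le_div_of_nonneg_right ?_ (hq j).le
    split_ifs <;> linarith [(hy j).2]
  have hmom1 := sum_qVec_gainEst (μ := μ) (δ := δ) (T := T) hw y
  have hmom2 := fun i => sum_qVec_gainEst_sq_le (μ := μ) (δ := δ) (T := T) hw i (hy i)
  set V := massOn G w with hVd
  set q := qVec k μ δ T w with hqd
  set E := gainEst k μ δ T w y with hE
  set β := beta k μ δ T with hβd
  set e := eta μ T with he
  set m := (G.card : ℝ) with hm
  set K := (k : ℝ) with hK
  have hk0 : 0 < K := by linarith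
  have hmk : m ≤ m * K ∧ K ≤ m * K ∧ 1 ≤ m * K :=
    ⟨le_mul_of_one_le_right (by linarith) hk1, le_mul_of_one_le_left (by linarith) hm1,
      by nlinarith⟩
  have hmkk : m * K ≤ m ^ 2 * K := by nlinarith
  have hβs : m * K * β ≤ 1 / 44 := by linarith
  have hβ1 : β ≤ 1 / 44 := by linarith [mul_le_mul_of_nonneg_right hmk.2.2 hβ0]
  -- The factor 44 in `hβ` is 4 · 11, with 11mk bounding 1/q_j.
  have hβq : β * (1 / q j) ≤ Δ / 4 := by
    linarith [mul_le_mul_of_nonneg_left hqj hβ0]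
  have hβq0 : 0 ≤ β * (1 / q j) := mul_nonneg hβ0 (one_div_pos.2 (hq j)).le
  set r : Fin k → ℝ := fun i => w i / V with hr
  have hr0 : ∀ i, 0 ≤ r i := fun i => (div_pos (hw i) hV).le
  have hrs : ∑ i ∈ G, r i = 1 := by
    rw [hr, ← Finset.sum_div]; exact div_self hV.ne'
  set Z : Fin k → ℝ := fun J => ∑ i ∈ G, r i * E J i with hZ
  have hZnn : ∀ J, 0 ≤ Z J := by
    intro J
    refine Finset.sum_nonneg fun i _ => mul_nonneg (hr0 i) (div_nonneg ?_ (hq i).le)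
    split_ifs
    · linarith [(hy i).1]
    · linarith
  -- Cauchy–Schwarz for the convex weights r.
  have hZsq : ∀ J, Z J ^ 2 ≤ ∑ i ∈ G, r i * E J i ^ 2 := by
    intro J
    have := Finset.sum_sq_le_sum_mul_sum_of_sq_le_mul G (r := fun i => r i * E J i) (f := r)
      (g := fun i => r i * E J i ^ 2) (fun i _ => hr0 i)
      (fun i _ => mul_nonneg (hr0 i) (sq_nonneg _)) (fun i _ => le_of_eq (by ring))
    rwa [hrs, one_mul] at this
  have hEZ : ∑ J, q J * Z J = ∑ i ∈ G, r i * (y i + β / q i) := by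
    simp only [hZ, Finset.mul_sum]
    rw [Finset.sum_comm]
    refine Finset.sum_congr rfl fun i _ => ?_
    rw [← hmom1 i, Finset.mul_sum]
    exact Finset.sum_congr rfl fun J _ => by ring
  have hEZ2 : ∑ J, q J * Z J ^ 2 ≤ 9 * (m ^ 2 * K) := by
    calc ∑ J, q J * Z J ^ 2 ≤ ∑ J, q J * ∑ i ∈ G, r i * E J i ^ 2 :=
          Finset.sum_le_sum fun J _ => mul_le_mul_of_nonneg_left (hZsq J) (hq J).le
      _ = ∑ i ∈ G, r i * ∑ J, q J * E J i ^ 2 := by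
          simp only [Finset.mul_sum]
          rw [Finset.sum_comm]
          exact Finset.sum_congr rfl fun i _ => Finset.sum_congr rfl fun J _ => by ring
      _ ≤ ∑ i ∈ G, (8 * (m * K) + 1) := by
          refine Finset.sum_le_sum fun i hi => ?_
          have h1 := mul_le_mul_of_nonneg_left (hmom2 i) (hr0 i)
          obtain ⟨h2, h3⟩ := hrq i hi
          have h4 : 2 * β ^ 2 * (r i * (1 / q i) ^ 2) ≤ 2 * β ^ 2 * (20 * (m * K) ^ 2) :=
            mul_le_mul_of_nonneg_left h3 (by positivity)
          have h5 : β ^ 2 * (m * K) ^ 2 ≤ 1 / 1936 := by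
            have h6 : 0 ≤ m * K * β := by positivity
            nlinarith
          linarith
      _ = m * (8 * (m * K) + 1) := by rw [Finset.sum_const, nsmul_eq_mul]
      _ ≤ _ := by nlinarith
  have hEj2 : ∑ J, q J * E J j ^ 2 ≤ 23 * (m ^ 2 * K) := by
    have h1 := hmom2 j
    have h2 : β ^ 2 * (1 / q j) ^ 2 ≤ 1 / 16 := by
      rw [← mul_pow]
      nlinarith
    linarith
  set X : Fin k → ℝ := fun J => lam * (e * E J j - e * Z J + e * Δ / 2) with hX
  have hle0 : 0 < lam * e := mul_pos hlam hη
  have hΔ0 : 0 < Δ := by rw [← hlamη]; positivity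
  -- An upper bound suffices, so the nonnegative Z, which may be large, is dropped.
  have hX1 : ∀ J, X J ≤ 1 := by
    intro J
    have h1 : E J j ≤ 11 * (m * K) + 1 / 4 := by linarith [hM1 J]
    have h2 : X J ≤ lam * e * (12 * (m ^ 2 * K)) := by
      have : X J = lam * e * (E J j - Z J + Δ / 2) := by rw [hX]; ring
      rw [this]
      refine mul_le_mul_of_nonneg_left ?_ hle0.le
      linarith [hZnn J]
    linarith
  have hX2 : ∀ J, X J ^ 2 ≤ (lam * e) ^ 2 * (3 * E J j ^ 2 + 3 * Z J ^ 2 + 3 / 4) := by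
    intro J
    have : X J ^ 2 = (lam * e) ^ 2 * (E J j - Z J + Δ / 2) ^ 2 := by rw [hX]; ring
    rw [this]
    refine mul_le_mul_of_nonneg_left ?_ (sq_nonneg _)
    have h1 : Δ ^ 2 ≤ 1 := by
      rw [sq_le_one_iff₀ hΔ0.le]; exact hΔ1
    linarith [sq_nonneg (E J j + Z J), sq_nonneg (E J j - Δ / 2), sq_nonneg (Z J + Δ / 2)]
  calc ∑ J, q J * Real.exp (X J) ≤ ∑ J, q J * (1 + X J +
        (lam * e) ^ 2 * (3 * E J j ^ 2 + 3 * Z J ^ 2 + 3 / 4)) := by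
        refine Finset.sum_le_sum fun J _ => mul_le_mul_of_nonneg_left ?_ (hq J).le
        exact (exp_le_one_add_add_sq (hX1 J)).trans (by linarith [hX2 J])
    _ = ∑ J, q J * (1 + lam * e * Δ / 2 + (lam * e) ^ 2 * (3 / 4)) +
        lam * e * ∑ J, q J * E J j - lam * e * ∑ J, q J * Z J +
        (lam * e) ^ 2 * 3 * ∑ J, q J * E J j ^ 2 +
        (lam * e) ^ 2 * 3 * ∑ J, q J * Z J ^ 2 := by
        simp only [Finset.mul_sum, ← Finset.sum_add_distrib, ← Finset.sum_sub_distrib]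
        refine Finset.sum_congr rfl fun J _ => ?_
        rw [hX]
        ring
    _ ≤ 1 + lam * e * Δ / 2 + (lam * e) ^ 2 * (3 / 4) + lam * e * (y j + Δ / 4) -
        lam * e * ∑ i ∈ G, r i * y i +
        (lam * e) ^ 2 * 3 * (23 * (m ^ 2 * K)) + (lam * e) ^ 2 * 3 * (9 * (m ^ 2 * K)) := by
        rw [← Finset.sum_mul, hqs, one_mul, hmom1, hEZ]
        have h1 : ∑ i ∈ G, r i * y i ≤ ∑ i ∈ G, r i * (y i + β / q i) :=
          Finset.sum_le_sum fun i _ => mul_le_mul_of_nonneg_left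
            (by linarith [div_nonneg hβ0 (hq i).le]) (hr0 i)
        have h2 : y j + β / q j ≤ y j + Δ / 4 := by
          rw [← mul_one_div]; linarith
        gcongr
    _ ≤ 1 + lam * e * (y j - ∑ i ∈ G, r i * y i + Δ) := by
        -- The barrier motion Δ/2 and the bias Δ/4 leave Δ/4 for the second-order terms. Those sum
        -- to at most (3/4 + 69 + 27) m²k (λη)², and 408/4 = 102 exceeds this coefficient.
        have h1 : (lam * e) ^ 2 * (m ^ 2 * K) * 408 = lam * e * Δ := by
          rw [← hlamη]; ring
        have h2 : (lam * e) ^ 2 ≤ (lam * e) ^ 2 * (m ^ 2 * K) :=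
          le_mul_of_one_le_right (sq_nonneg _) (by linarith [hmk.2.2])
        generalize ∑ i ∈ G, r i * y i = Y
        generalize m ^ 2 * K = A at h1 h2
        generalize lam * e = L at h1 h2
        clear * - h1 h2
        ring_nf at h1 h2 ⊢
        linarith [sq_nonneg L]

end Barrier

/-! ### The barrier and its exponential potential -/

section BarrierPotential

variable {k : ℕ} {μ δ : ℝ} {T : ℕ}

/-- The level below which the weights of the arms outside `G`, relative to the total weight of `G`,
remain with high probability: it decreases exponentially to the order of `1 / k ^ 2`. -/
def barrierLevel (k : ℕ) (r : ℝ) (n : ℕ) : ℝ :=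
  Real.exp 1 * max (Real.exp (-(r * n / 2))) (1 / (k : ℝ) ^ 2)

lemma barrierLevel_pos (r : ℝ) (n : ℕ) : 0 < barrierLevel k r n :=
  mul_pos (Real.exp_pos _) (lt_max_of_lt_left (Real.exp_pos _))

lemma one_div_sq_le_barrierLevel (r : ℝ) (n : ℕ) : 1 / (k : ℝ) ^ 2 ≤ barrierLevel k r n := by
  have h : 1 / (k : ℝ) ^ 2 ≤ max (Real.exp (-(r * n / 2))) (1 / (k : ℝ) ^ 2) := le_max_right _ _
  have h0 : 0 ≤ 1 / (k : ℝ) ^ 2 := by positivity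
  have h1 : 1 ≤ Real.exp 1 := Real.one_le_exp zero_le_one
  unfold barrierLevel
  nlinarith

lemma barrierLevel_le_four [NeZero k] {r : ℝ} (hr : 0 ≤ r) (n : ℕ) : barrierLevel k r n ≤ 4 := by
  have h : max (Real.exp (-(r * n / 2))) (1 / (k : ℝ) ^ 2) ≤ 1 := by
    refine max_le (Real.exp_le_one_iff.2 (by have := mul_nonneg hr n.cast_nonneg; linarith)) ?_
    exact div_le_one_of_le₀ (one_le_pow₀ one_le_cast_of_neZero) (by positivity)
  have h2 : Real.exp 1 ≤ 4 := by linarith [Real.exp_one_lt_d9]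
  have h3 : 0 ≤ max (Real.exp (-(r * n / 2))) (1 / (k : ℝ) ^ 2) := le_max_of_le_left
    (Real.exp_pos _).le
  unfold barrierLevel
  nlinarith [Real.exp_pos 1]

/-- With r = ηΔ the barrier sinks at no more than half the mean speed that the gap provides. -/
lemma log_barrierLevel_sub_le {r : ℝ} (hr : 0 ≤ r) (n : ℕ) :
    Real.log (barrierLevel k r n) - Real.log (barrierLevel k r (n + 1)) ≤ r / 2 := by
  rw [sub_le_iff_le_add, ← Real.log_exp (r / 2),
    ← Real.log_mul (Real.exp_pos _).ne' (barrierLevel_pos r (n + 1)).ne']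
  refine Real.log_le_log (barrierLevel_pos r n) ?_
  unfold barrierLevel
  rw [mul_left_comm]
  refine mul_le_mul_of_nonneg_left ?_ (Real.exp_pos _).le
  rw [mul_max_of_nonneg _ _ (Real.exp_pos _).le, ← Real.exp_add]
  refine max_le_max (Real.exp_le_exp.2 ?_) ?_
  · push_cast; linarith
  · exact le_mul_of_one_le_left (by positivity) (Real.one_le_exp (by linarith))

/-- The logarithm of the weight of arm `j` relative to the barrier. -/
def logExcess (k : ℕ) (r : ℝ) (G : Finset (Fin k)) (n : ℕ) (w : Fin k → ℝ) (j : Fin k) : ℝ :=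
  Real.log (w j) - Real.log (massOn G w) - Real.log (barrierLevel k r n)

/-- How much the arms outside `G` exceed the barrier after the current round. -/
def violation (k : ℕ) (μ δ : ℝ) (T : ℕ) (r : ℝ) (G : Finset (Fin k)) (n : ℕ)
    (w y : Fin k → ℝ) (a : Fin k × Fin k) : ℝ :=
  ∑ l ∈ Gᶜ, max 0 (nextWeight k μ δ T w y a.2 l -
    barrierLevel k r (n + 1) * massOn G (nextWeight k μ δ T w y a.2))

/-- An exponential potential that is at least `1` once an arm outside `G` has crossed the
barrier. -/
def barrierPotential (k : ℕ) (μ δ : ℝ) (T : ℕ) (r lam : ℝ) (G : Finset (Fin k)) (n : ℕ)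
    (g : ℕ → Fin k → ℝ) (h : Fin n → Fin k × Fin k) : ℝ :=
  if cumul k μ δ T (violation k μ δ T r G) g n h = 0 then
    ∑ j ∈ Gᶜ, Real.exp (lam * logExcess k r G n (weight k μ δ T g n h) j)
  else 1

lemma violation_nonneg (r : ℝ) (G : Finset (Fin k)) (n : ℕ) (w y : Fin k → ℝ)
    (a : Fin k × Fin k) : 0 ≤ violation k μ δ T r G n w y a :=
  Finset.sum_nonneg fun _ _ => le_max_left _ _

lemma barrierPotential_nonneg (r lam : ℝ) (G : Finset (Fin k)) (n : ℕ) (g : ℕ → Fin k → ℝ)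
    (h : Fin n → Fin k × Fin k) : 0 ≤ barrierPotential k μ δ T r lam G n g h := by
  unfold barrierPotential
  split_ifs
  · exact Finset.sum_nonneg fun j _ => (Real.exp_pos _).le
  · exact zero_le_one

lemma le_of_violation_eq_zero {r : ℝ} {G : Finset (Fin k)} {n : ℕ} {w y : Fin k → ℝ}
    {a : Fin k × Fin k} (h : violation k μ δ T r G n w y a = 0) {l : Fin k} (hl : l ∉ G) :
    nextWeight k μ δ T w y a.2 l ≤
      barrierLevel k r (n + 1) * massOn G (nextWeight k μ δ T w y a.2) := by
  have := (Finset.sum_eq_zero_iff_of_nonneg fun _ _ => le_max_left _ _).1 h l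
    (Finset.mem_compl.2 hl)
  linarith [max_eq_left_iff.1 this]

lemma exists_lt_of_violation_ne_zero {r : ℝ} {G : Finset (Fin k)} {n : ℕ} {w y : Fin k → ℝ}
    {a : Fin k × Fin k} (h : violation k μ δ T r G n w y a ≠ 0) :
    ∃ l ∉ G, barrierLevel k r (n + 1) * massOn G (nextWeight k μ δ T w y a.2) <
      nextWeight k μ δ T w y a.2 l := by
  by_contra! hcon
  refine h (Finset.sum_eq_zero fun l hl => max_eq_left ?_)
  linarith [hcon l (Finset.mem_compl.1 hl)]

lemma cumul_nonneg {F : ℕ → (Fin k → ℝ) → (Fin k → ℝ) → Fin k × Fin k → ℝ}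
    (hF : ∀ n w y a, 0 ≤ F n w y a) (g : ℕ → Fin k → ℝ) (n : ℕ) (h : Fin n → Fin k × Fin k) :
    0 ≤ cumul k μ δ T F g n h := by
  induction n with
  | zero => exact le_rfl
  | succ n ih => exact add_nonneg (ih _) (hF _ _ _ _)

lemma weight_le_of_cumul_violation_eq_zero [NeZero k] {r : ℝ} {G : Finset (Fin k)}
    (hG : G.Nonempty) {g : ℕ → Fin k → ℝ} {n : ℕ} {h : Fin n → Fin k × Fin k}
    (h0 : cumul k μ δ T (violation k μ δ T r G) g n h = 0) {l : Fin k} (hl : l ∉ G) :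
    weight k μ δ T g n h l ≤ barrierLevel k r n * massOn G (weight k μ δ T g n h) := by
  cases n with
  | zero =>
    -- The violations only record weights after an update, so the start needs a check: the barrier
    -- begins at least at 1 and G has mass at least 1.
    have hm1 : (1 : ℝ) ≤ G.card := by exact_mod_cast hG.card_pos
    have h1 : 1 ≤ Real.exp 1 := Real.one_le_exp zero_le_one
    have h2 : (1 : ℝ) ≤ max 1 ((k : ℝ) ^ 2)⁻¹ := le_max_left _ _
    have h3 : 1 ≤ barrierLevel k r 0 := by
      simp only [barrierLevel, Nat.cast_zero, mul_zero, zero_div, neg_zero, Real.exp_zero, one_div]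
      nlinarith
    simp only [weight, massOn, Finset.sum_const, nsmul_eq_mul, mul_one]
    nlinarith
  | succ n =>
    rw [cumul] at h0
    have h1 := cumul_nonneg (μ := μ) (δ := δ) (T := T)
      (violation_nonneg (μ := μ) (δ := δ) (T := T) r G) g n (Fin.init h)
    have h2 := violation_nonneg (μ := μ) (δ := δ) (T := T) r G n
      (weight k μ δ T g n (Fin.init h)) (g n) (h (Fin.last n))
    rw [weight_succ]
    exact le_of_violation_eq_zero (by linarith) hl

lemma measurable_massOn (G : Finset (Fin k)) : Measurable fun w : Fin k → ℝ => massOn G w :=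
  Finset.measurable_sum _ fun i _ => measurable_pi_apply i

lemma measurable_violation (r : ℝ) (G : Finset (Fin k)) (n : ℕ) (a : Fin k × Fin k) :
    Measurable fun z : (Fin k → ℝ) × (Fin k → ℝ) => violation k μ δ T r G n z.1 z.2 a := by
  have h := measurable_nextWeight (μ := μ) (δ := δ) (T := T) a.2
  refine Finset.measurable_sum _ fun l _ => measurable_const.max ?_
  exact ((measurable_pi_apply l).comp h).sub (((measurable_massOn G).comp h).const_mul _)

lemma measurable_logExcess (r : ℝ) (G : Finset (Fin k)) (n : ℕ) (j : Fin k) :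
    Measurable fun w : Fin k → ℝ => logExcess k r G n w j :=
  (((measurable_pi_apply j).log).sub (measurable_massOn G).log).sub_const _

variable {w : Fin k → ℝ}

/-- Jensen's inequality for exp with the shares of the arms in G as weights. It lets G act as one
arm, even if its arms have different means. -/
lemma massOn_mul_exp_le {G : Finset (Fin k)} (hG : G.Nonempty) (hw : ∀ j, 0 < w j)
    (y : Fin k → ℝ) (J : Fin k) :
    Real.log (massOn G w) +
      eta μ T * ∑ i ∈ G, w i / massOn G w * gainEst k μ δ T w y J i ≤
      Real.log (massOn G (nextWeight k μ δ T w y J)) := by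
  have hV := massOn_pos hG hw
  have hjen := convexOn_exp.map_sum_le (t := G) (w := fun i => w i / massOn G w)
    (p := fun i => eta μ T * gainEst k μ δ T w y J i)
    (fun i _ => (div_pos (hw i) hV).le)
    (by rw [← Finset.sum_div]; exact div_self hV.ne') (fun i _ => Set.mem_univ _)
  rw [← Real.log_exp (eta μ T * _), ← Real.log_mul hV.ne' (Real.exp_pos _).ne']
  refine Real.log_le_log (mul_pos hV (Real.exp_pos _)) ?_
  have h1 : ∑ i ∈ G, (w i / massOn G w) • (eta μ T * gainEst k μ δ T w y J i) =
      eta μ T * ∑ i ∈ G, w i / massOn G w * gainEst k μ δ T w y J i := by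
    rw [Finset.mul_sum]
    exact Finset.sum_congr rfl fun i _ => by rw [smul_eq_mul]; ring
  rw [h1] at hjen
  refine (mul_le_mul_of_nonneg_left hjen hV.le).trans (le_of_eq ?_)
  rw [Finset.mul_sum]
  change _ = ∑ i ∈ G, nextWeight k μ δ T w y J i
  refine Finset.sum_congr rfl fun i _ => ?_
  rw [nextWeight_eq, smul_eq_mul]
  field_simp

lemma logExcess_nextWeight_le {G : Finset (Fin k)} (hG : G.Nonempty) (hw : ∀ j, 0 < w j)
    {Δ : ℝ} (hr : 0 ≤ eta μ T * Δ) (n : ℕ) (y : Fin k → ℝ) (J j : Fin k) :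
    logExcess k (eta μ T * Δ) G (n + 1) (nextWeight k μ δ T w y J) j ≤
      logExcess k (eta μ T * Δ) G n w j + (eta μ T * gainEst k μ δ T w y J j -
        eta μ T * ∑ i ∈ G, w i / massOn G w * gainEst k μ δ T w y J i + eta μ T * Δ / 2) := by
  have h1 := massOn_mul_exp_le (μ := μ) (δ := δ) (T := T) hG hw y J
  have h2 := log_barrierLevel_sub_le (k := k) hr n
  have h3 : Real.log (nextWeight k μ δ T w y J j) =
      Real.log (w j) + eta μ T * gainEst k μ δ T w y J j := by
    rw [nextWeight_eq, Real.log_mul (hw j).ne' (Real.exp_pos _).ne', Real.log_exp]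
  unfold logExcess
  linarith

lemma logExcess_nonneg_of_lt {r : ℝ} {G : Finset (Fin k)} (hG : G.Nonempty) (hw : ∀ j, 0 < w j)
    {n : ℕ} {j : Fin k} (h : barrierLevel k r n * massOn G w < w j) :
    0 ≤ logExcess k r G n w j := by
  have hB := barrierLevel_pos (k := k) r n
  have hV := massOn_pos hG hw
  have := Real.log_le_log (mul_pos hB hV) h.le
  rw [Real.log_mul hB.ne' hV.ne'] at this
  unfold logExcess
  linarith

/-- The assumptions under which arms outside `G` do not cross the barrier. -/
structure BarrierRegime (k : ℕ) (μ δ : ℝ) (T : ℕ) (G : Finset (Fin k)) (Δ lam : ℝ) : Prop where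
  gap_le_one : Δ ≤ 1
  eta_pos : 0 < eta μ T
  eta_le_one : eta μ T ≤ 1
  beta_nonneg : 0 ≤ beta k μ δ T
  beta_le : 44 * G.card * k * beta k μ δ T ≤ Δ
  gamma_lt_one : gamma k μ δ T < 1
  lam_pos : 0 < lam
  lam_eq : 408 * (G.card : ℝ) ^ 2 * k * (lam * eta μ T) = Δ

variable [NeZero k] {G : Finset (Fin k)} {Δ lam : ℝ} {ν : Measure (Fin k → ℝ)}

lemma BarrierRegime.gap_pos (H : BarrierRegime k μ δ T G Δ lam) (hG : G.Nonempty) : 0 < Δ := by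
  have hm1 : (0 : ℝ) < G.card := by exact_mod_cast hG.card_pos
  have := H.eta_pos
  have := H.lam_pos
  have := cast_pos_of_neZero (k := k)
  rw [← H.lam_eq]
  positivity

/-- Near the barrier the negative drift prevents growth in mean. Far below, the drift is not
controlled since 1/q_j may be large, but the mixing bounds a single step and the new potential is at
most exp(-λ). -/
lemma BarrierRegime.hasAffineBound_arm (H : BarrierRegime k μ δ T G Δ lam) (hG : G.Nonempty)
    (hgap : ∀ i ∈ G, ∀ j ∉ G, (∫ x, x j ∂ν) + Δ ≤ ∫ x, x i ∂ν) (hw : ∀ j, 0 < w j) (n : ℕ)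
    (halive : ∀ l ∉ G, w l ≤ barrierLevel k (eta μ T * Δ) n * massOn G w) {j : Fin k}
    (hj : j ∉ G) :
    HasAffineBound ν (fun y => ∑ J, qVec k μ δ T w J * Real.exp (lam *
        logExcess k (eta μ T * Δ) G (n + 1) (nextWeight k μ δ T w y J) j))
      (Real.exp (lam * logExcess k (eta μ T * Δ) G n w j) + Real.exp (-lam)) := by
  have hΔ := H.gap_pos hG
  have hr : 0 ≤ eta μ T * Δ := mul_nonneg H.eta_pos.le hΔ.le
  have hV := massOn_pos hG hw
  have hB := barrierLevel_pos (k := k) (eta μ T * Δ) n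
  have hq := qVec_pos (μ := μ) (δ := δ) (T := T) hw
  set L := logExcess k (eta μ T * Δ) G n w j with hL
  -- As 25 ≥ e³, an arm outside this zone has log-excess at most -3; one round adds at most 1 + ηΔ/2
  -- ≤ 3/2, so it stays below -1.
  by_cases hzone : barrierLevel k (eta μ T * Δ) n * massOn G w ≤ 25 * w j
  · set c := Real.exp (lam * L) * (lam * eta μ T) with hc
    have hc0 : 0 ≤ c := mul_nonneg (Real.exp_pos _).le (mul_pos H.lam_pos H.eta_pos).le
    have hsum : ∀ y : Fin k → ℝ, ∑ l, c * ((if l = j then 1 else 0) -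
        (if l ∈ G then w l / massOn G w else 0)) * y l =
        c * (y j - ∑ i ∈ G, w i / massOn G w * y i) := by
      intro y
      simp only [mul_assoc, ← Finset.mul_sum, sub_mul, Finset.sum_sub_distrib, ite_mul, one_mul,
        zero_mul, Finset.sum_ite_eq', Finset.mem_univ, if_true, Finset.sum_ite_mem,
        Finset.univ_inter]
    refine ⟨Real.exp (lam * L) + c * Δ, fun l => c * ((if l = j then 1 else 0) -
        (if l ∈ G then w l / massOn G w else 0)), fun y hy => ?_, ?_⟩
    · rw [hsum]
      have hd := sum_exp_drift_le (μ := μ) (δ := δ) (T := T) hw hG H.gap_le_one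
        (one_div_sq_le_barrierLevel (k := k) (eta μ T * Δ) n) (barrierLevel_le_four hr n)
        H.eta_pos H.beta_nonneg H.beta_le H.lam_pos H.lam_eq halive hzone hy
      calc _ ≤ ∑ J, Real.exp (lam * L) * (qVec k μ δ T w J * Real.exp (lam *
            (eta μ T * gainEst k μ δ T w y J j - eta μ T * ∑ i ∈ G, w i / massOn G w *
              gainEst k μ δ T w y J i + eta μ T * Δ / 2))) := by
            refine Finset.sum_le_sum fun J _ => ?_
            rw [mul_left_comm, ← Real.exp_add, ← mul_add]
            refine mul_le_mul_of_nonneg_left (Real.exp_le_exp.2 ?_) (hq J).le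
            exact mul_le_mul_of_nonneg_left (logExcess_nextWeight_le hG hw hr n y J j)
              H.lam_pos.le
        _ ≤ Real.exp (lam * L) * (1 + lam * eta μ T *
            (y j - ∑ i ∈ G, w i / massOn G w * y i + Δ)) := by
            rw [← Finset.mul_sum]
            exact mul_le_mul_of_nonneg_left hd (Real.exp_pos _).le
        _ = _ := by rw [hc]; ring
    · rw [hsum fun l => ∫ x, x l ∂ν]
      -- The gap survives any convex combination over G and cancels the term c * Δ.
      have h1 : (∫ x, x j ∂ν) + Δ ≤ ∑ i ∈ G, w i / massOn G w * ∫ x, x i ∂ν := by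
        have h2 : ∑ i ∈ G, w i / massOn G w = 1 := by
          rw [← Finset.sum_div]; exact div_self hV.ne'
        calc (∫ x, x j ∂ν) + Δ = ∑ i ∈ G, w i / massOn G w * ((∫ x, x j ∂ν) + Δ) := by
              rw [← Finset.sum_mul, h2, one_mul]
          _ ≤ _ := Finset.sum_le_sum fun i hi =>
              mul_le_mul_of_nonneg_left (hgap i hi j hj) (div_pos (hw i) hV).le
      have h2 := mul_le_mul_of_nonneg_left h1 hc0
      have h3 := Real.exp_pos (-lam)
      nlinarith
  · push Not at hzone
    refine (HasAffineBound.const (Real.exp (-lam))).mono (fun y hy => ?_)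
      (by linarith [Real.exp_pos (lam * L)])
    have hbound : ∀ J, logExcess k (eta μ T * Δ) G (n + 1) (nextWeight k μ δ T w y J) j ≤ -1 := by
      intro J
      have h1 := logExcess_nextWeight_le (μ := μ) (δ := δ) (T := T) hG hw hr n y J j
      rw [← hL] at h1
      have h2 : L ≤ -3 := by
        have h3 := Real.log_le_log (mul_pos (by norm_num) (hw j)) hzone.le
        rw [Real.log_mul (by norm_num) (hw j).ne', Real.log_mul hB.ne' hV.ne'] at h3
        have h4 : (3 : ℝ) ≤ Real.log 25 := by
          rw [Real.le_log_iff_exp_le (by norm_num)]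
          have h5 : Real.exp 3 = Real.exp 1 ^ 3 := by rw [← Real.exp_nat_mul]; norm_num
          rw [h5]
          calc Real.exp 1 ^ 3 ≤ 2.72 ^ 3 :=
                pow_le_pow_left₀ (Real.exp_pos _).le (by linarith [Real.exp_one_lt_d9]) 3
            _ ≤ 25 := by norm_num
        rw [hL, logExcess]
        linarith
      have h3 : eta μ T * gainEst k μ δ T w y J j ≤ 1 := by
        refine le_trans ?_ (eta_mul_div_qVec_le_one (μ := μ) (δ := δ) (T := T) hw H.eta_pos
          H.beta_nonneg H.gamma_lt_one j)
        refine mul_le_mul_of_nonneg_left ?_ H.eta_pos.le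
        refine div_le_div_of_nonneg_right ?_ (hq j).le
        split_ifs <;> linarith [(hy j).2]
      have h4 : 0 ≤ eta μ T * ∑ i ∈ G, w i / massOn G w * gainEst k μ δ T w y J i := by
        refine mul_nonneg H.eta_pos.le (Finset.sum_nonneg fun i _ =>
          mul_nonneg (div_pos (hw i) hV).le (div_nonneg ?_ (hq i).le))
        have := H.beta_nonneg
        split_ifs <;> linarith [(hy i).1]
      have h5 : eta μ T * Δ ≤ 1 := by nlinarith [H.eta_le_one, H.gap_le_one, H.eta_pos]
      linarith
    calc _ ≤ ∑ J, qVec k μ δ T w J * Real.exp (-lam) := by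
          refine Finset.sum_le_sum fun J _ => mul_le_mul_of_nonneg_left
            (Real.exp_le_exp.2 ?_) (hq J).le
          nlinarith [hbound J, H.lam_pos]
      _ = Real.exp (-lam) := by rw [← Finset.sum_mul, qVec_sum hw, one_mul]

/-- Before a crossing the bounds of the single arms add up. At a crossing the responsible arm has
nonnegative log-excess, so the exponential sum is at least the frozen value 1; afterwards the
process is constant. -/
lemma BarrierRegime.isAlmostSupermartingale (H : BarrierRegime k μ δ T G Δ lam) (hG : G.Nonempty)
    (hgap : ∀ i ∈ G, ∀ j ∉ G, (∫ x, x j ∂ν) + Δ ≤ ∫ x, x i ∂ν) :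
    IsAlmostSupermartingale k μ δ T ν (k * Real.exp (-lam))
      fun n => barrierPotential k μ δ T (eta μ T * Δ) lam G n where
  nonneg n g h := barrierPotential_nonneg _ _ _ _ _ _
  meas n h := by
    unfold barrierPotential
    refine Measurable.ite ?_ ?_ measurable_const
    · exact measurable_cumul (fun n a => measurable_violation _ G n a) n h
        (measurableSet_singleton 0)
    · exact Finset.measurable_sum _ fun j _ =>
        (((measurable_logExcess _ G n j).comp (measurable_weight n h)).const_mul _).exp
  step n g h := by
    have hw := weight_pos (k := k) (μ := μ) (δ := δ) (T := T) g n h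
    have hc0 : 0 ≤ k * Real.exp (-lam) := by positivity
    by_cases h0 : cumul k μ δ T (violation k μ δ T (eta μ T * Δ) G) g n h = 0
    · have halive := fun l (hl : l ∉ G) => weight_le_of_cumul_violation_eq_zero hG h0 hl
      set w := weight k μ δ T g n h with hwd
      have hsum := HasAffineBound.sum Gᶜ fun j hj =>
        H.hasAffineBound_arm hG hgap hw n halive (Finset.mem_compl.1 hj)
      refine hsum.mono (fun y hy => ?_) ?_
      · have hle : ∀ i J, barrierPotential k μ δ T (eta μ T * Δ) lam G (n + 1)
            (Function.update g n y) (snocHist h (i, J)) ≤ ∑ j ∈ Gᶜ, Real.exp (lam *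
              logExcess k (eta μ T * Δ) G (n + 1) (nextWeight k μ δ T w y J) j) := by
          intro i J
          rw [barrierPotential, cumul_update_snoc, h0, zero_add, weight_update_snoc, ← hwd]
          split_ifs with hv
          · exact le_rfl
          · obtain ⟨l, hl, hlt⟩ := exists_lt_of_violation_ne_zero hv
            have h1 := logExcess_nonneg_of_lt hG
              (nextWeight_pos (μ := μ) (δ := δ) (T := T) hw y J) hlt
            exact (Real.one_le_exp (mul_nonneg H.lam_pos.le h1)).trans
              (Finset.single_le_sum (f := fun j => Real.exp (lam *
                logExcess k (eta μ T * Δ) G (n + 1) (nextWeight k μ δ T w y J) j))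
                (fun j _ => (Real.exp_pos _).le) (Finset.mem_compl.2 hl))
        calc _ ≤ ∑ i, ∑ J, pVec k μ δ T w i * qVec k μ δ T w J * ∑ j ∈ Gᶜ, Real.exp (lam *
              logExcess k (eta μ T * Δ) G (n + 1) (nextWeight k μ δ T w y J) j) :=
              Finset.sum_le_sum fun i _ => Finset.sum_le_sum fun J _ =>
                mul_le_mul_of_nonneg_left (hle i J)
                  (mul_nonneg (pVec_nonneg hw i) (qVec_nonneg w J))
          _ = _ := by
              rw [sum_pVec_qVec hw fun J => ∑ j ∈ Gᶜ, Real.exp (lam *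
                logExcess k (eta μ T * Δ) G (n + 1) (nextWeight k μ δ T w y J) j)]
              simp only [Finset.mul_sum]
              rw [Finset.sum_comm]
      · rw [barrierPotential, if_pos h0, Finset.sum_add_distrib, Finset.sum_const, nsmul_eq_mul]
        have : ((Gᶜ).card : ℝ) ≤ k := by
          exact_mod_cast (Finset.card_le_univ _).trans_eq (Fintype.card_fin k)
        have := mul_le_mul_of_nonneg_right this (Real.exp_pos (-lam)).le
        linarith
    · have hpos := lt_of_le_of_ne (cumul_nonneg (μ := μ) (δ := δ) (T := T)
        (violation_nonneg (μ := μ) (δ := δ) (T := T) (eta μ T * Δ) G) g n h) (Ne.symm h0)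
      refine (HasAffineBound.const 1).mono (fun y _ => le_of_eq ?_) ?_
      · have h1 : ∀ i j, barrierPotential k μ δ T (eta μ T * Δ) lam G (n + 1)
            (Function.update g n y) (snocHist h (i, j)) = 1 := by
          intro i j
          rw [barrierPotential, if_neg]
          rw [cumul_update_snoc]
          have := violation_nonneg (μ := μ) (δ := δ) (T := T) (eta μ T * Δ) G n
            (weight k μ δ T g n h) y (i, j)
          linarith
        simp only [h1]
        rw [sum_pVec_qVec hw fun _ => 1]
        simp [qVec_sum hw]
      · rw [barrierPotential, if_neg h0]
        linarith

end BarrierPotential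

/-! ### The combined failure potential -/

section Potentials

variable {k : ℕ} {μ δ : ℝ} {T : ℕ} {ν : Measure (Fin k → ℝ)}

lemma IsAlmostSupermartingale.const_mul {c b : ℝ} (hb : 0 ≤ b)
    {M : (n : ℕ) → (ℕ → Fin k → ℝ) → (Fin n → Fin k × Fin k) → ℝ}
    (hM : IsAlmostSupermartingale k μ δ T ν c M) :
    IsAlmostSupermartingale k μ δ T ν (b * c) fun n g h => b * M n g h where
  nonneg n g h := mul_nonneg hb (hM.nonneg n g h)
  meas n h := (hM.meas n h).const_mul b
  step n g h := by
    obtain ⟨a₀, a, h1, h2⟩ := hM.step n g h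
    refine ⟨b * a₀, fun l => b * a l, fun y hy => ?_, ?_⟩
    · have := mul_le_mul_of_nonneg_left (h1 y hy) hb
      simp only [mul_add, Finset.mul_sum] at this ⊢
      refine le_trans (le_of_eq ?_) (this.trans (le_of_eq ?_))
      · exact Finset.sum_congr rfl fun i _ => Finset.sum_congr rfl fun j _ => by ring
      · simp only [mul_assoc]
    · have := mul_le_mul_of_nonneg_left h2 hb
      simp only [mul_add, Finset.mul_sum] at this
      simpa only [mul_assoc] using this

lemma cumul_lincomb (F F' : ℕ → (Fin k → ℝ) → (Fin k → ℝ) → Fin k × Fin k → ℝ) (a b : ℝ)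
    (g : ℕ → Fin k → ℝ) (n : ℕ) (h : Fin n → Fin k × Fin k) :
    cumul k μ δ T (fun n w y c => a * F n w y c + b * F' n w y c) g n h =
      a * cumul k μ δ T F g n h + b * cumul k μ δ T F' g n h := by
  induction n with
  | zero => simp [cumul]
  | succ n ih => rw [cumul, cumul, cumul, ih]; ring

lemma cumul_eq_sum (f : (Fin k → ℝ) → Fin k × Fin k → ℝ) (g : ℕ → Fin k → ℝ) (n : ℕ)
    (h : Fin n → Fin k × Fin k) :
    cumul k μ δ T (fun _ _ y a => f y a) g n h = ∑ t : Fin n, f (g t) (h t) := by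
  induction n with
  | zero => simp [cumul]
  | succ n ih => rw [cumul, ih, Fin.sum_univ_castSucc]; rfl

lemma isAlmostSupermartingale_exp_cumul
    {F : ℕ → (Fin k → ℝ) → (Fin k → ℝ) → Fin k × Fin k → ℝ}
    (hF : ∀ n a, Measurable fun z : (Fin k → ℝ) × (Fin k → ℝ) => F n z.1 z.2 a)
    (hstep : ∀ n w, (∀ j, 0 < w j) → ∀ y, (∀ i, y i ∈ Set.Icc (0 : ℝ) 1) →
      ∑ i, ∑ j, pVec k μ δ T w i * qVec k μ δ T w j * Real.exp (F n w y (i, j)) ≤ 1) :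
    IsAlmostSupermartingale k μ δ T ν 0 fun n g h => Real.exp (cumul k μ δ T F g n h) where
  nonneg n g h := (Real.exp_pos _).le
  meas n h := (measurable_cumul hF n h).exp
  step n g h := by
    refine (HasAffineBound.const (Real.exp (cumul k μ δ T F g n h))).mono (fun y hy => ?_)
      (by rw [add_zero])
    simp only [cumul_update_snoc, Real.exp_add]
    have := mul_le_mul_of_nonneg_left (hstep n _ (weight_pos (μ := μ) (δ := δ) (T := T) g n h) y hy)
      (Real.exp_pos (cumul k μ δ T F g n h)).le
    rw [mul_one] at this
    refine le_trans (le_of_eq ?_) this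
    simp only [Finset.mul_sum]
    exact Finset.sum_congr rfl fun i _ => Finset.sum_congr rfl fun j _ => by ring

lemma measurable_gainDiff (a : Fin k × Fin k) :
    Measurable fun z : (Fin k → ℝ) × (Fin k → ℝ) => gainDiff k μ δ T z.1 z.2 a := by
  unfold gainDiff
  exact ((((measurable_pVec a.2).div (measurable_qVec a.2)).comp measurable_fst).mul
    ((measurable_pi_apply a.2).comp measurable_snd)).sub
    ((measurable_pi_apply a.1).comp measurable_snd)

/-- The potential whose smallness makes all estimates of the regret analysis hold. -/
def failurePotential (k : ℕ) (μ δ : ℝ) (T : ℕ) (r lam x : ℝ) (G : Finset (Fin k)) (n : ℕ)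
    (g : ℕ → Fin k → ℝ) (h : Fin n → Fin k × Fin k) : ℝ :=
  Real.exp (-x) * ((∑ i, Real.exp (eta μ T * cumul k μ δ T (fun _ _ y _ => y i) g n h) /
      weight k μ δ T g n h i) +
    Real.exp (cumul k μ δ T (fun _ w y a => eta μ T * gainDiff k μ δ T w y a +
        -(4 * eta μ T ^ 2) * sqrtMass k μ δ T w ^ 2) g n h)) +
  barrierPotential k μ δ T r lam G n g h

variable {G : Finset (Fin k)} {Δ lam : ℝ}

/-- The factor e in `barrierLevel` starts every arm at log-excess at most -1, hence the exp(-λ). -/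
lemma failurePotential_zero_le (hG : G.Nonempty) (hlam : 0 ≤ lam) {r x : ℝ} :
    failurePotential k μ δ T r lam x G 0 0 Fin.elim0 ≤
      Real.exp (-x) * (k + 1) + k * Real.exp (-lam) := by
  have hm1 : (1 : ℝ) ≤ G.card := by exact_mod_cast hG.card_pos
  have hB : (1 : ℝ) ≤ Real.log (barrierLevel k r 0) := by
    rw [Real.le_log_iff_exp_le (barrierLevel_pos r 0), barrierLevel]
    exact le_mul_of_one_le_right (Real.exp_pos _).le (by simp)
  have h1 : ∀ j, Real.exp (lam * logExcess k r G 0 (fun _ => 1) j) ≤ Real.exp (-lam) := by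
    intro j
    refine Real.exp_le_exp.2 ?_
    have : logExcess k r G 0 (fun _ => 1) j ≤ -1 := by
      simp only [logExcess, massOn, Real.log_one, Finset.sum_const, nsmul_eq_mul, mul_one]
      linarith [Real.log_nonneg hm1]
    nlinarith
  unfold failurePotential barrierPotential
  simp only [cumul, weight, if_true, mul_zero, Real.exp_zero, div_one, Finset.sum_const,
    Finset.card_univ, Fintype.card_fin, nsmul_eq_mul, mul_one]
  refine add_le_add le_rfl ((Finset.sum_le_sum fun j _ => h1 j).trans ?_)
  rw [Finset.sum_const, nsmul_eq_mul]
  refine mul_le_mul_of_nonneg_right ?_ (Real.exp_pos _).le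
  exact_mod_cast (Finset.card_le_univ _).trans_eq (Fintype.card_fin k)

variable [NeZero k]

/-- Since log w_i is η times the estimated gains, the process is the exponential of η times true
minus estimated gains. -/
lemma isAlmostSupermartingale_gain_div_weight (hη : 0 < eta μ T) (hη1 : eta μ T ≤ 1)
    (hηβ : eta μ T ≤ beta k μ δ T) (i : Fin k) :
    IsAlmostSupermartingale k μ δ T ν 0 fun n g h =>
      Real.exp (eta μ T * cumul k μ δ T (fun _ _ y _ => y i) g n h) /
        weight k μ δ T g n h i where
  nonneg n g h := div_nonneg (Real.exp_pos _).le (weight_pos g n h i).le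
  meas n h := ((measurable_cumul (fun _ _ => (measurable_pi_apply i).comp measurable_snd)
    n h).const_mul _).exp.div ((measurable_pi_apply i).comp (measurable_weight n h))
  step n g h := by
    have hw := weight_pos (k := k) (μ := μ) (δ := δ) (T := T) g n h
    refine (HasAffineBound.const _).mono (fun y hy => ?_) (by rw [add_zero])
    simp only [cumul_update_snoc, weight_update_snoc]
    rw [sum_pVec_qVec hw fun J => Real.exp (eta μ T * (cumul k μ δ T (fun _ _ y _ => y i) g n h +
      y i)) / nextWeight k μ δ T (weight k μ δ T g n h) y J i]
    have := mul_le_mul_of_nonneg_left (sum_exp_div_nextWeight_le hw hη hη1 hηβ i (hy i))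
      (Real.exp_pos (eta μ T * cumul k μ δ T (fun _ _ y _ => y i) g n h)).le
    rw [mul_one_div] at this
    refine le_trans (le_of_eq ?_) this
    rw [Finset.mul_sum]
    refine Finset.sum_congr rfl fun J _ => ?_
    rw [mul_add, Real.exp_add]
    ring

lemma isAlmostSupermartingale_gainDiff (hη : 0 < eta μ T) (hη1 : eta μ T * k ≤ 1) :
    IsAlmostSupermartingale k μ δ T ν 0 fun n g h =>
      Real.exp (cumul k μ δ T (fun _ w y a => eta μ T * gainDiff k μ δ T w y a +
        -(4 * eta μ T ^ 2) * sqrtMass k μ δ T w ^ 2) g n h) := by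
  refine isAlmostSupermartingale_exp_cumul (fun n a => ?_) fun n w hw y hy => ?_
  · exact ((measurable_gainDiff a).const_mul _).add
      (((measurable_sqrtMass.comp measurable_fst).pow_const 2).const_mul _)
  · simpa only [neg_mul, ← sub_eq_add_neg] using sum_exp_gainDiff_le hw hη hη1 hy

lemma BarrierRegime.isAlmostSupermartingale_failurePotential
    (H : BarrierRegime k μ δ T G Δ lam) (hG : G.Nonempty)
    (hgap : ∀ i ∈ G, ∀ j ∉ G, (∫ x, x j ∂ν) + Δ ≤ ∫ x, x i ∂ν)
    (hηβ : eta μ T ≤ beta k μ δ T) (hηk : eta μ T * k ≤ 1) (x : ℝ) :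
    IsAlmostSupermartingale k μ δ T ν (k * Real.exp (-lam))
      fun n => failurePotential k μ δ T (eta μ T * Δ) lam x G n := by
  have h := (((IsAlmostSupermartingale.sum (ν := ν) Finset.univ fun i _ =>
    isAlmostSupermartingale_gain_div_weight (k := k) (μ := μ) (δ := δ) (T := T)
      H.eta_pos H.eta_le_one hηβ i).add
    (isAlmostSupermartingale_gainDiff H.eta_pos hηk)).const_mul (Real.exp_pos (-x)).le).add
    (H.isAlmostSupermartingale hG hgap)
  simp only [Finset.sum_const_zero, add_zero, mul_zero, zero_add] at h
  exact h

end Potentials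

/-! ### Pathwise regret analysis -/

section Pathwise

variable {k : ℕ} [NeZero k] {μ δ : ℝ} {T : ℕ}

/-- The growth of the logarithm of the total weight in one round. -/
lemma log_sum_nextWeight_le {w y : Fin k → ℝ} (hw : ∀ j, 0 < w j)
    (hy : ∀ i, y i ∈ Set.Icc (0 : ℝ) 1) (hη : 0 < eta μ T) (hβ0 : 0 ≤ beta k μ δ T)
    (hβ : k * beta k μ δ T ^ 2 ≤ 1) (hγ : gamma k μ δ T < 1) (J : Fin k) :
    (1 - gamma k μ δ T) * (Real.log (∑ j, nextWeight k μ δ T w y J j) - Real.log (∑ j, w j)) ≤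
      eta μ T * (pVec k μ δ T w J / qVec k μ δ T w J * y J) +
        (eta μ T * beta k μ δ T + 4 * eta μ T ^ 2) * sqrtMass k μ δ T w ^ 2 := by
  have hW := sum_weight_pos hw
  have hW' := sum_weight_pos (nextWeight_pos (μ := μ) (δ := δ) (T := T) hw y J)
  have hq := qVec_pos (μ := μ) (δ := δ) (T := T) hw
  have hp := pVec_pos (μ := μ) (δ := δ) (T := T) hw
  -- From log z ≤ z - 1. The factor 1 - γ of the claim later replaces w_j/W by p_j.
  have hlog : Real.log (∑ j, nextWeight k μ δ T w y J j) - Real.log (∑ j, w j) ≤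
      ∑ j, w j / (∑ l, w l) * (Real.exp (eta μ T * gainEst k μ δ T w y J j) - 1) := by
    rw [← Real.log_div hW'.ne' hW.ne']
    refine (Real.log_le_sub_one_of_pos (div_pos hW' hW)).trans (le_of_eq ?_)
    simp only [nextWeight_eq, mul_sub, mul_one, Finset.sum_sub_distrib, ← Finset.sum_div,
      div_self hW.ne', div_mul_eq_mul_div]
  have hE0 : ∀ j, 0 ≤ gainEst k μ δ T w y J j := by
    intro j
    refine div_nonneg ?_ (hq j).le
    split_ifs <;> linarith [(hy j).1]
  have hE1 : ∀ j, eta μ T * gainEst k μ δ T w y J j ≤ 1 := by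
    intro j
    refine le_trans ?_ (eta_mul_div_qVec_le_one (μ := μ) (δ := δ) (T := T) hw hη hβ0 hγ j)
    refine mul_le_mul_of_nonneg_left (div_le_div_of_nonneg_right ?_ (hq j).le) hη.le
    split_ifs <;> linarith [(hy j).2]
  have hterm : ∀ j, (1 - gamma k μ δ T) * (w j / (∑ l, w l) *
      (Real.exp (eta μ T * gainEst k μ δ T w y J j) - 1)) ≤
      eta μ T * (pVec k μ δ T w j * gainEst k μ δ T w y J j) +
      eta μ T ^ 2 * (pVec k μ δ T w j * gainEst k μ δ T w y J j ^ 2) := by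
    intro j
    have h1 := one_sub_gamma_mul_le_pVec (μ := μ) (δ := δ) (T := T) w j
    have h2 := exp_le_one_add_add_sq (hE1 j)
    have h3 : 0 ≤ eta μ T * gainEst k μ δ T w y J j := mul_nonneg hη.le (hE0 j)
    have h4 : 0 ≤ Real.exp (eta μ T * gainEst k μ δ T w y J j) - 1 := by
      linarith [Real.one_le_exp h3]
    calc _ = (1 - gamma k μ δ T) * (w j / ∑ l, w l) *
          (Real.exp (eta μ T * gainEst k μ δ T w y J j) - 1) := by ring
      _ ≤ pVec k μ δ T w j * (Real.exp (eta μ T * gainEst k μ δ T w y J j) - 1) :=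
          mul_le_mul_of_nonneg_right h1 h4
      _ ≤ pVec k μ δ T w j * (eta μ T * gainEst k μ δ T w y J j +
          (eta μ T * gainEst k μ δ T w y J j) ^ 2) :=
          mul_le_mul_of_nonneg_left (by linarith) (hp j).le
      _ = _ := by ring
  have hfirst : ∑ j, pVec k μ δ T w j * gainEst k μ δ T w y J j =
      pVec k μ δ T w J / qVec k μ δ T w J * y J +
        beta k μ δ T * sqrtMass k μ δ T w ^ 2 := by
    rw [← sum_pVec_div_qVec hw, Finset.mul_sum]
    have : ∀ j, pVec k μ δ T w j * gainEst k μ δ T w y J j =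
        (if J = j then pVec k μ δ T w j / qVec k μ δ T w j * y j else 0) +
          beta k μ δ T * (pVec k μ δ T w j / qVec k μ δ T w j) := by
      intro j
      unfold gainEst
      split_ifs <;> ring
    simp only [this, Finset.sum_add_distrib, Finset.sum_ite_eq, Finset.mem_univ, if_true]
  -- With p_j/q_j² = S² the sum is at most S²(2 + 2kβ²), and kβ² ≤ 1.
  have hsecond : ∑ j, pVec k μ δ T w j * gainEst k μ δ T w y J j ^ 2 ≤
      4 * sqrtMass k μ δ T w ^ 2 := by
    have : ∀ j, pVec k μ δ T w j * gainEst k μ δ T w y J j ^ 2 ≤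
        sqrtMass k μ δ T w ^ 2 * (2 * (if J = j then 1 else 0) + 2 * beta k μ δ T ^ 2) := by
      intro j
      rw [← pVec_div_qVec_sq hw j]
      have h1 : pVec k μ δ T w j * gainEst k μ δ T w y J j ^ 2 =
          pVec k μ δ T w j / qVec k μ δ T w j ^ 2 *
            ((if J = j then y j else 0) + beta k μ δ T) ^ 2 := by
        unfold gainEst
        rw [div_pow]
        ring
      rw [h1]
      refine mul_le_mul_of_nonneg_left ?_ (div_nonneg (hp j).le (sq_nonneg _))
      split_ifs
      · nlinarith [(hy j).1, (hy j).2, sq_nonneg (y j - beta k μ δ T)]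
      · nlinarith [sq_nonneg (beta k μ δ T)]
    refine (Finset.sum_le_sum fun j _ => this j).trans ?_
    simp only [← Finset.mul_sum, Finset.sum_add_distrib, Finset.sum_ite_eq, Finset.mem_univ,
      if_true, Finset.sum_const, Finset.card_univ, Fintype.card_fin, nsmul_eq_mul]
    nlinarith [sq_nonneg (sqrtMass k μ δ T w)]
  have hγ0 : 0 ≤ 1 - gamma k μ δ T := by linarith
  calc _ ≤ (1 - gamma k μ δ T) * ∑ j, w j / (∑ l, w l) *
        (Real.exp (eta μ T * gainEst k μ δ T w y J j) - 1) :=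
        mul_le_mul_of_nonneg_left hlog hγ0
    _ ≤ eta μ T * (∑ j, pVec k μ δ T w j * gainEst k μ δ T w y J j) +
        eta μ T ^ 2 * ∑ j, pVec k μ δ T w j * gainEst k μ δ T w y J j ^ 2 := by
        simp only [Finset.mul_sum, ← Finset.sum_add_distrib]
        exact Finset.sum_le_sum fun j _ => hterm j
    _ ≤ eta μ T * (pVec k μ δ T w J / qVec k μ δ T w J * y J +
        beta k μ δ T * sqrtMass k μ δ T w ^ 2) +
        eta μ T ^ 2 * (4 * sqrtMass k μ δ T w ^ 2) := by
        rw [hfirst]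
        gcongr
    _ = _ := by ring

lemma log_sum_weight_le {g : ℕ → Fin k → ℝ} {n : ℕ}
    (hg : ∀ t < n, ∀ i, g t i ∈ Set.Icc (0 : ℝ) 1)
    (hη : 0 < eta μ T) (hβ0 : 0 ≤ beta k μ δ T)
    (hβ : k * beta k μ δ T ^ 2 ≤ 1) (hγ : gamma k μ δ T < 1) (h : Fin n → Fin k × Fin k) :
    (1 - gamma k μ δ T) * (Real.log (∑ j, weight k μ δ T g n h j) - Real.log k) ≤
      eta μ T * (cumul k μ δ T (fun _ w y a => gainDiff k μ δ T w y a) g n h +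
        cumul k μ δ T (fun _ _ y a => y a.1) g n h) +
      (eta μ T * beta k μ δ T + 4 * eta μ T ^ 2) *
        cumul k μ δ T (fun _ w _ _ => sqrtMass k μ δ T w ^ 2) g n h := by
  induction n with
  | zero => simp [weight, cumul]
  | succ n ih =>
    have h1 := ih (fun t ht => hg t (by omega)) (Fin.init h)
    have h2 := log_sum_nextWeight_le (μ := μ) (δ := δ) (T := T)
      (weight_pos (μ := μ) (δ := δ) (T := T) g n (Fin.init h)) (hg n (by omega)) hη hβ0 hβ hγ
      (h (Fin.last n)).2
    simp only [weight_succ, cumul, gainDiff] at h1 h2 ⊢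
    linarith

/-- The total weight dominates the weight of each arm, which by `hgain` has logarithm at least η
times its gains minus x. `hdiff` passes from importance weighted to collected gains at the cost of
another x and 4η² ∑ S², which makes 8η² in total. The factor 1 - γ costs ηγT. -/
lemma regret_le {g : ℕ → Fin k → ℝ} (hg : ∀ t < T, ∀ i, g t i ∈ Set.Icc (0 : ℝ) 1)
    (hη : 0 < eta μ T) (hβ0 : 0 ≤ beta k μ δ T)
    (hβ : k * beta k μ δ T ^ 2 ≤ 1) (hγ : gamma k μ δ T < 1) {h : Fin T → Fin k × Fin k}
    {x : ℝ} (hx : 0 ≤ x)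
    (hgain : ∀ i, Real.exp (-x) * (Real.exp (eta μ T *
      cumul k μ δ T (fun _ _ y _ => y i) g T h) / weight k μ δ T g T h i) ≤ 1)
    (hdiff : Real.exp (-x) * Real.exp (cumul k μ δ T (fun _ w y a =>
      eta μ T * gainDiff k μ δ T w y a + -(4 * eta μ T ^ 2) * sqrtMass k μ δ T w ^ 2) g T h) ≤ 1) :
    eta μ T * regret T g h ≤ eta μ T * gamma k μ δ T * T + 2 * x + Real.log k +
      (eta μ T * beta k μ δ T + 8 * eta μ T ^ 2) *
        cumul k μ δ T (fun _ w _ _ => sqrtMass k μ δ T w ^ 2) g T h := by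
  have hw := weight_pos (k := k) (μ := μ) (δ := δ) (T := T) g T h
  have hlogk : 0 ≤ Real.log k := Real.log_nonneg one_le_cast_of_neZero
  have hγ0 := gamma_nonneg (k := k) (μ := μ) (δ := δ) (T := T)
  have hpath := log_sum_weight_le hg hη hβ0 hβ hγ h
  rw [← Real.exp_add, Real.exp_le_one_iff, cumul_lincomb fun _ w y a => gainDiff k μ δ T w y a]
    at hdiff
  rw [regret]
  have hcol := cumul_eq_sum (μ := μ) (δ := δ) (T := T) (fun y (a : Fin k × Fin k) => y a.1) g T h
  rw [← hcol]
  suffices hs : ∀ i, eta μ T * ∑ t : Fin T, g t i ≤ eta μ T * gamma k μ δ T * T + 2 * x +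
      Real.log k + (eta μ T * beta k μ δ T + 8 * eta μ T ^ 2) *
        cumul k μ δ T (fun _ w _ _ => sqrtMass k μ δ T w ^ 2) g T h +
      eta μ T * cumul k μ δ T (fun _ _ y a => y a.1) g T h by
    rw [mul_sub, sub_le_iff_le_add, ← le_div_iff₀' hη]
    refine ciSup_le fun i => ?_
    rw [le_div_iff₀' hη]
    exact hs i
  intro i
  have hGi := cumul_eq_sum (μ := μ) (δ := δ) (T := T) (fun y (_ : Fin k × Fin k) => y i) g T h
  have hGT : ∑ t : Fin T, g t i ≤ T := by
    have := Finset.sum_le_sum fun (t : Fin T) (_ : t ∈ Finset.univ) => (hg t t.2 i).2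
    simpa using this
  have hi := hgain i
  rw [hGi, ← mul_div_assoc, div_le_one (hw i), ← Real.exp_add, ← Real.le_log_iff_exp_le (hw i)]
    at hi
  have hlogi : Real.log (weight k μ δ T g T h i) ≤ Real.log (∑ j, weight k μ δ T g T h j) :=
    Real.log_le_log (hw i) (Finset.single_le_sum (fun l _ => (hw l).le) (Finset.mem_univ i))
  have h1 : (1 - gamma k μ δ T) * (-x + eta μ T * ∑ t : Fin T, g t i - Real.log k) ≤
      (1 - gamma k μ δ T) * (Real.log (∑ j, weight k μ δ T g T h j) - Real.log k) :=
    mul_le_mul_of_nonneg_left (by linarith) (by linarith)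
  have h2 : eta μ T * gamma k μ δ T * ∑ t : Fin T, g t i ≤ eta μ T * gamma k μ δ T * T :=
    mul_le_mul_of_nonneg_left hGT (mul_nonneg hη.le hγ0)
  have h3 := mul_nonneg hγ0 hx
  have h4 := mul_nonneg hγ0 hlogk
  linarith

/-- From round 4 log k / r on, exp(-rn/2) ≤ 1/k², so B = e/k² and k√B = √e ≤ 2. Earlier rounds use
the trivial bound S² ≤ k. -/
lemma sqrtMass_sq_le_of_alive {w : Fin k → ℝ} (hw : ∀ j, 0 < w j) {G : Finset (Fin k)}
    (hG : G.Nonempty) {r : ℝ} (hr : 0 < r) (n : ℕ)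
    (halive : ∀ l ∉ G, w l ≤ barrierLevel k r n * massOn G w) :
    sqrtMass k μ δ T w ^ 2 ≤ (2 * ((G.card : ℝ) + 2) ^ 2 + 2 * (k * gamma k μ δ T)) +
      if n < ⌈4 * Real.log k / r⌉₊ then (k : ℝ) else 0 := by
  have hk0 := cast_pos_of_neZero (k := k)
  have h0 : 0 ≤ 2 * ((G.card : ℝ) + 2) ^ 2 + 2 * (k * gamma k μ δ T) := by
    have := mul_nonneg hk0.le (gamma_nonneg (k := k) (μ := μ) (δ := δ) (T := T))
    positivity
  split_ifs with hn
  · linarith [sqrtMass_sq_le (μ := μ) (δ := δ) (T := T) hw]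
  · rw [add_zero]
    have hn' : 4 * Real.log k ≤ n * r := by
      rw [not_lt, Nat.ceil_le, div_le_iff₀ hr] at hn
      exact hn
    have hB : barrierLevel k r n = Real.exp 1 / (k : ℝ) ^ 2 := by
      rw [barrierLevel, max_eq_right, mul_one_div]
      rw [one_div, ← Real.exp_log (pow_pos hk0 2), ← Real.exp_neg, Real.log_pow]
      refine Real.exp_le_exp.2 ?_
      push_cast
      linarith
    have hkB : k * √(barrierLevel k r n) ≤ 2 := by
      rw [hB, Real.sqrt_div (Real.exp_pos _).le, Real.sqrt_sq hk0.le, mul_div_cancel₀ _ hk0.ne']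
      exact Real.sqrt_le_iff.2 ⟨by norm_num, by linarith [Real.exp_one_lt_d9]⟩
    have h1 := sum_sqrt_div_massOn_le hG hw halive
    have h2 := sqrtMass_sq_le_add (μ := μ) (δ := δ) (T := T) hw (massOn_pos hG hw) (massOn_le hw)
    have h3 : 0 ≤ ∑ l, √(w l / massOn G w) := Finset.sum_nonneg fun _ _ => Real.sqrt_nonneg _
    have h4 := pow_le_pow_left₀ h3 (h1.trans (add_le_add le_rfl hkB)) 2
    linarith

lemma cumul_sqrtMass_le {g : ℕ → Fin k → ℝ} {G : Finset (Fin k)} (hG : G.Nonempty) {r : ℝ}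
    (hr : 0 < r) {n : ℕ} {h : Fin n → Fin k × Fin k}
    (h0 : cumul k μ δ T (violation k μ δ T r G) g n h = 0) :
    cumul k μ δ T (fun _ w _ _ => sqrtMass k μ δ T w ^ 2) g n h ≤
      n * (2 * ((G.card : ℝ) + 2) ^ 2 + 2 * (k * gamma k μ δ T)) +
        k * (4 * Real.log k / r + 1) := by
  have hk0 := cast_pos_of_neZero (k := k)
  set b := 2 * ((G.card : ℝ) + 2) ^ 2 + 2 * (k * gamma k μ δ T) with hb
  set N := ⌈4 * Real.log k / r⌉₊ with hN
  have hmain : cumul k μ δ T (fun _ w _ _ => sqrtMass k μ δ T w ^ 2) g n h ≤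
      n * b + ∑ t ∈ Finset.range n, if t < N then (k : ℝ) else 0 := by
    induction n with
    | zero => simp [cumul]
    | succ n ih =>
      rw [cumul] at h0
      have h1 := cumul_nonneg (μ := μ) (δ := δ) (T := T)
        (violation_nonneg (μ := μ) (δ := δ) (T := T) r G) g n (Fin.init h)
      have h2 := violation_nonneg (μ := μ) (δ := δ) (T := T) r G n
        (weight k μ δ T g n (Fin.init h)) (g n) (h (Fin.last n))
      have h3 : cumul k μ δ T (violation k μ δ T r G) g n (Fin.init h) = 0 := by linarith
      have h4 := sqrtMass_sq_le_of_alive (μ := μ) (δ := δ) (T := T)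
        (weight_pos g n (Fin.init h)) hG hr n
        fun l hl => weight_le_of_cumul_violation_eq_zero hG h3 hl
      rw [cumul, Finset.sum_range_succ]
      push_cast
      linarith [ih h3]
  refine hmain.trans (add_le_add le_rfl ?_)
  rw [← Finset.sum_filter, Finset.sum_const, nsmul_eq_mul, mul_comm]
  refine mul_le_mul_of_nonneg_left ?_ hk0.le
  have hcard : ((Finset.range n).filter (· < N)).card ≤ N := by
    calc _ ≤ (Finset.range N).card := Finset.card_le_card fun t ht =>
          Finset.mem_range.2 (Finset.mem_filter.1 ht).2
      _ = N := Finset.card_range N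
  have h1 : 0 ≤ 4 * Real.log k / r :=
    div_nonneg (mul_nonneg (by norm_num) (Real.log_nonneg one_le_cast_of_neZero)) hr.le
  exact (Nat.cast_le.2 hcard).trans (Nat.ceil_lt_add_one h1).le

end Pathwise

/-! ### Markov's inequality over rewards and algorithm -/

section Probability

variable {k : ℕ} [NeZero k] {μ δ : ℝ} {T : ℕ} {ν : Measure (Fin k → ℝ)} [IsProbabilityMeasure ν]

/-- Markov's inequality for an almost supermartingale, over the joint randomness of i.i.d. rewards
and of the algorithm. -/
lemma IsAlmostSupermartingale.one_sub_le_lintegral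
    (hν : ∀ᵐ x ∂ν, ∀ i, x i ∈ Set.Icc (0 : ℝ) 1) {c : ℝ} (hc : 0 ≤ c)
    {M : (n : ℕ) → (ℕ → Fin k → ℝ) → (Fin n → Fin k × Fin k) → ℝ}
    (hM : IsAlmostSupermartingale k μ δ T ν c M) {ε : ℝ} (hε : 0 ≤ ε)
    (hM0 : M 0 0 Fin.elim0 + T * c ≤ ε)
    {good : (ℕ → Fin k → ℝ) → Set (Fin T → Fin k × Fin k)}
    (hcongr : ∀ g g' : ℕ → Fin k → ℝ, (∀ t < T, g t = g' t) → good g = good g')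
    (hgood : ∀ g : ℕ → Fin k → ℝ, (∀ t < T, ∀ i, g t i ∈ Set.Icc (0 : ℝ) 1) →
      ∀ h, M T g h < 1 → h ∈ good g)
    {Ω : Type*} [MeasurableSpace Ω] {P : Measure Ω} [IsProbabilityMeasure P]
    {X : ℕ → Ω → Fin k → ℝ} (hX : ∀ t < T, ProbabilityTheory.HasLaw (X t) ν P)
    (hind : ProbabilityTheory.iIndepFun (fun t : Fin T => X t) P) :
    ENNReal.ofReal (1 - ε) ≤
      ∫⁻ ω, (run k μ δ T (fun t => X t ω) T).toOuterMeasure (good fun t => X t ω) ∂P := by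
  set B : (Fin T → Fin k → ℝ) → ENNReal := fun x =>
    ∑ h, run k μ δ T (extendZero x) T h * ENNReal.ofReal (M T (extendZero x) h) with hB
  have hBmeas : Measurable B := Finset.measurable_sum _ fun h _ =>
    ((measurable_run _ h).comp (measurable_extendZero _)).mul
      ((hM.meas _ h).comp (measurable_extendZero _)).ennreal_ofReal
  have hXm : ∀ t : Fin T, AEMeasurable (X t) P := fun t => (hX t t.2).aemeasurable
  have hXm' : AEMeasurable (fun ω (t : Fin T) => X t ω) P := aemeasurable_pi_lambda _ hXm
  have hmap : P.map (fun ω (t : Fin T) => X t ω) = Measure.pi fun _ => ν := by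
    rw [(ProbabilityTheory.iIndepFun_iff_map_fun_eq_pi_map hXm).1 hind]
    congr 1
    funext t
    exact (hX t t.2).map_eq
  have hBint : ∫⁻ ω, B (fun t : Fin T => X t ω) ∂P ≤ ENNReal.ofReal ε := by
    rw [← lintegral_map' hBmeas.aemeasurable hXm', hmap]
    refine (hM.lintegral_run_le hν hc T).trans ?_
    rw [← ENNReal.ofReal_natCast, ← ENNReal.ofReal_mul T.cast_nonneg,
      ← ENNReal.ofReal_add (hM.nonneg _ _ _) (mul_nonneg T.cast_nonneg hc)]
    exact ENNReal.ofReal_le_ofReal hM0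
  have hcube : ∀ᵐ ω ∂P, ∀ t : Fin T, ∀ i, X t ω i ∈ Set.Icc (0 : ℝ) 1 := by
    rw [ae_all_iff]
    intro t
    have h1 := hν
    rw [← (hX t t.2).map_eq] at h1
    exact ae_of_ae_map (hXm t) h1
  -- Markov's inequality for fixed rewards: each history is good or has potential at least 1.
  -- Rewards after round T are arbitrary, so they are first replaced by zeros.
  have hone : ∀ᵐ ω ∂P, (1 : ENNReal) ≤
      (run k μ δ T (fun t => X t ω) T).toOuterMeasure (good fun t => X t ω) +
        B (fun t : Fin T => X t ω) := by
    filter_upwards [hcube] with ω hω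
    have hext : ∀ t < T, (fun t => X t ω) t = extendZero (fun t : Fin T => X t ω) t := by
      intro t ht
      simp [extendZero, ht]
    rw [hcongr _ _ hext, run_congr hext, PMF.toOuterMeasure_apply_fintype, hB,
      ← Finset.sum_add_distrib]
    set g := extendZero (fun t : Fin T => X t ω) with hg
    have hgc : ∀ t < T, ∀ i, g t i ∈ Set.Icc (0 : ℝ) 1 := by
      intro t ht i
      rw [← hext t ht]
      exact hω ⟨t, ht⟩ i
    rw [← PMF.tsum_coe (run k μ δ T g T), tsum_fintype]
    refine Finset.sum_le_sum fun h _ => ?_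
    by_cases hh : h ∈ good g
    · rw [Set.indicator_of_mem hh]
      exact le_self_add
    · have h1 : 1 ≤ M T g h := by
        by_contra! hcon
        exact hh (hgood g hgc h hcon)
      have h2 : (1 : ENNReal) ≤ ENNReal.ofReal (M T g h) := ENNReal.one_le_ofReal.2 h1
      exact le_add_of_nonneg_of_le zero_le (le_mul_of_one_le_right zero_le h2)
  have hBm : AEMeasurable (fun ω => B fun t : Fin T => X t ω) P :=
    hBmeas.comp_aemeasurable hXm'
  have hsum := lintegral_mono_ae hone
  rw [lintegral_const, measure_univ, mul_one,
    lintegral_add_right' _ hBm] at hsum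
  rw [ENNReal.ofReal_sub _ hε, ENNReal.ofReal_one]
  exact tsub_le_iff_right.2 (hsum.trans (add_le_add le_rfl hBint))

end Probability

/-! ### Arithmetic of the rate and short horizons -/

section Rates

lemma one_le_log_three_mul_div {k : ℕ} (hk : 2 ≤ k) {δ : ℝ} (hδ0 : 0 < δ) (hδ1 : δ < 1) :
    1 ≤ Real.log (3 * k / δ) := by
  have hk' : (2 : ℝ) ≤ k := by exact_mod_cast hk
  have h6 : 6 ≤ 3 * k / δ := by
    rw [le_div_iff₀ hδ0]; nlinarith
  rw [Real.le_log_iff_exp_le (by linarith)]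
  linarith [Real.exp_one_lt_d9]

/-- The exponent of the optimal step size parameter makes `√(k ^ E T)` at least
`k ^ (2 / 3) T ^ (1 / 3)`. -/
lemma sq_mul_le_rate_pow_three {k T : ℕ} (hk : 2 ≤ k) (hT : 1 ≤ T) :
    (k : ℝ) ^ 2 * T ≤ √((k : ℝ) ^ (max 0 (4 / 3 - 1 / 3 * Real.logb k T) : ℝ) * T) ^ 3 := by
  have hk' : (2 : ℝ) ≤ k := by exact_mod_cast hk
  have hk0 : (0 : ℝ) < k := by linarith
  have hT' : (1 : ℝ) ≤ T := by exact_mod_cast hT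
  have hT0 : (0 : ℝ) < T := by linarith
  set E := max 0 (4 / 3 - 1 / 3 * Real.logb k T) with hE
  have hlog : (k : ℝ) ^ Real.logb k T = T := Real.rpow_logb hk0 (by linarith) hT0
  -- This is 3E + log_k T ≥ 4. Multiplied by T² it is the square of the claim.
  have h1 : (k : ℝ) ^ 4 ≤ ((k : ℝ) ^ E) ^ 3 * T := by
    rw [← hlog, ← Real.rpow_natCast _ 3, ← Real.rpow_mul hk0.le, ← Real.rpow_add hk0,
      ← Real.rpow_natCast _ 4]
    refine Real.rpow_le_rpow_of_exponent_le (by linarith) ?_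
    have := le_max_right 0 (4 / 3 - 1 / 3 * Real.logb k T)
    rw [← hE] at this
    push_cast
    linarith
  have hU : 0 ≤ (k : ℝ) ^ E * T := mul_nonneg (Real.rpow_nonneg hk0.le _) hT0.le
  refine (pow_le_pow_iff_left₀ (by positivity) (by positivity) two_ne_zero).1 ?_
  rw [← pow_mul, mul_comm 3 2, pow_mul, Real.sq_sqrt hU, mul_pow, mul_pow]
  have := mul_le_mul_of_nonneg_right h1 (sq_nonneg (T : ℝ))
  nlinarith

lemma natCast_le_rate_sq {k T : ℕ} (hk : 2 ≤ k) :
    (T : ℝ) ≤ √((k : ℝ) ^ (max 0 (4 / 3 - 1 / 3 * Real.logb k T) : ℝ) * T) ^ 2 := by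
  have hk' : (2 : ℝ) ≤ k := by exact_mod_cast hk
  have h1 : 1 ≤ (k : ℝ) ^ (max 0 (4 / 3 - 1 / 3 * Real.logb k T) : ℝ) :=
    Real.one_le_rpow (by linarith) (le_max_left _ _)
  rw [Real.sq_sqrt (by positivity)]
  exact le_mul_of_one_le_left T.cast_nonneg h1

/-- For T ≥ k the cap on μ is inactive, so that η is the reciprocal of the rate. -/
lemma min_one_exponent {k T : ℕ} (hk : 2 ≤ k) (hkT : k ≤ T) :
    min 1 (max 0 (4 / 3 - 1 / 3 * Real.logb k T)) = max 0 (4 / 3 - 1 / 3 * Real.logb k T) := by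
  have hk' : (1 : ℝ) < k := by exact_mod_cast hk
  have h1 : 1 ≤ Real.logb k T := by
    rw [Real.le_logb_iff_rpow_le hk' (by linarith [(Nat.cast_le (α := ℝ)).2 hkT]),
      Real.rpow_one]
    exact_mod_cast hkT
  exact min_eq_right (max_le zero_le_one (by linarith))

/-- For horizons that are short compared with the number of arms, the claimed rate exceeds the
trivial bound `T` on the regret. -/
lemma natCast_le_of_rate_lt {k T : ℕ} (hk : 2 ≤ k) (hkT : k ≤ T) {δ s C₀ : ℝ} (hδ0 : 0 < δ)
    (hδ1 : δ < 1) (hs0 : 0 < s) (hs3 : (k : ℝ) ^ 2 * T ≤ s ^ 3) (hC₀ : 0 < C₀)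
    (hs : s < C₀ * k * Real.log (4 * k * T / δ)) :
    (T : ℝ) ≤ (8 * C₀) ^ 4 * Real.log (3 * k / δ) ^ 4 * s := by
  have hk' : (2 : ℝ) ≤ k := by exact_mod_cast hk
  have hk0 : (0 : ℝ) < k := by linarith
  have hkT' : (k : ℝ) ≤ T := by exact_mod_cast hkT
  have hℓ := one_le_log_three_mul_div hk hδ0 hδ1
  set ℓ := Real.log (3 * k / δ) with hℓd
  set R : ℝ := T / k with hR
  have hR1 : 1 ≤ R := by rw [hR, le_div_iff₀ hk0]; linarith
  -- The sixth root gives T = kz⁶ and s ≥ kz², so T ≤ z⁴s, while log(T/k) ≤ 6z is only linear in z.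
  -- The assumption on s then forces z ≤ 8C₀ℓ.
  set z := R ^ ((1 : ℝ) / 6) with hz
  have hz1 : 1 ≤ z := Real.one_le_rpow hR1 (by norm_num)
  have hz6 : z ^ 6 = R := by
    rw [hz, ← Real.rpow_natCast, ← Real.rpow_mul (by linarith)]
    norm_num
  have hTz : (T : ℝ) = k * z ^ 6 := by rw [hz6, hR]; field_simp
  have hlogR : Real.log R ≤ 6 * z := by
    rw [← hz6, Real.log_pow]
    have := Real.log_le_sub_one_of_pos (show 0 < z by linarith)
    push_cast
    linarith
  have hΛ : Real.log (4 * k * T / δ) ≤ 2 * ℓ + 6 * z := by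
    have h1 : 4 * k * T / δ = 4 * (k : ℝ) ^ 2 / δ * R := by rw [hR]; field_simp
    have h2 : 4 * (k : ℝ) ^ 2 / δ ≤ (3 * k / δ) ^ 2 := by
      rw [div_pow, div_le_div_iff₀ hδ0 (by positivity)]
      have h3 : δ ^ 2 ≤ δ := by nlinarith
      nlinarith [mul_le_mul_of_nonneg_left h3 (sq_nonneg (k : ℝ)),
        mul_nonneg (sq_nonneg (k : ℝ)) hδ0.le]
    rw [h1, Real.log_mul (by positivity) (by linarith)]
    have h4 := Real.log_le_log (by positivity) h2
    rw [Real.log_pow] at h4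
    push_cast at h4
    linarith
  have hsz : k * z ^ 2 ≤ s := by
    refine (pow_le_pow_iff_left₀ (by positivity) hs0.le three_ne_zero).1 (le_trans ?_ hs3)
    rw [hTz]
    exact le_of_eq (by ring)
  have hzℓ : z ≤ 8 * C₀ * ℓ := by
    have h1 : k * z ^ 2 < k * (C₀ * (2 * ℓ + 6 * z)) := by
      calc k * z ^ 2 ≤ s := hsz
        _ < C₀ * k * Real.log (4 * k * T / δ) := hs
        _ ≤ C₀ * k * (2 * ℓ + 6 * z) := by gcongr
        _ = _ := by ring
    have h2 : z ^ 2 < C₀ * (2 * ℓ + 6 * z) := lt_of_mul_lt_mul_left h1 hk0.le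
    have h3 : 2 * ℓ + 6 * z ≤ 8 * ℓ * z := by nlinarith
    have h4 : z * z < 8 * C₀ * ℓ * z := by nlinarith [mul_le_mul_of_nonneg_left h3 hC₀.le]
    exact (lt_of_mul_lt_mul_right h4 (by linarith)).le
  calc (T : ℝ) = z ^ 4 * (k * z ^ 2) := by rw [hTz]; ring
    _ ≤ (8 * C₀ * ℓ) ^ 4 * s := by gcongr
    _ = _ := by ring

end Rates

/-! ### Parameters, final estimate and assembly -/

section Main

variable {k : ℕ} {μ δ : ℝ} {T : ℕ} {m Δ s : ℝ}

lemma regret_congr {g g' : ℕ → Fin k → ℝ} (hg : ∀ t < T, g t = g' t)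
    (h : Fin T → Fin k × Fin k) : regret T g h = regret T g' h := by
  have : ∀ t : Fin T, g t = g' t := fun t => hg t t.2
  simp only [regret, this]

lemma setOf_regret_le_congr {g g' : ℕ → Fin k → ℝ} (hg : ∀ t < T, g t = g' t) (R : ℝ) :
    {h | regret T g h ≤ R} = {h | regret T g' h ≤ R} := by
  rw [show regret T g = regret T g' from funext (regret_congr hg)]

/-- The bounds on the parameters of the algorithm for horizons that are not too short. -/
lemma parameter_bounds (hk : 2 ≤ k) (hT : 1 ≤ T) (hδ0 : 0 < δ) (hδ1 : δ < 1)
    (hm : 1 ≤ m) (hΔ0 : 0 < Δ) (hΔ1 : Δ ≤ 1) (hη : eta μ T = 1 / s) (hs0 : 0 < s)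
    (hs : 408 * m ^ 2 / Δ * k * Real.log (4 * k * T / δ) ≤ s) :
    eta μ T * k ≤ 1 ∧ eta μ T ≤ beta k μ δ T ∧
      beta k μ δ T ≤ 5 * eta μ T * Real.log (3 * k / δ) ∧ 44 * m * k * beta k μ δ T ≤ Δ ∧
      gamma k μ δ T ≤ 4 * eta μ T ^ 2 * k ^ 2 ∧ gamma k μ δ T < 1 := by
  have hk' : (2 : ℝ) ≤ k := by exact_mod_cast hk
  have hT' : (1 : ℝ) ≤ T := by exact_mod_cast hT
  have hk0 : (0 : ℝ) < k := by linarith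
  have hℓ := one_le_log_three_mul_div hk hδ0 hδ1
  have hΛ : Real.log (3 * k / δ) ≤ Real.log (4 * k * T / δ) := by
    refine Real.log_le_log (by positivity) (div_le_div_of_nonneg_right ?_ hδ0.le)
    nlinarith
  set ℓ := Real.log (3 * k / δ) with hℓd
  set e := eta μ T with he
  have he0 : 0 < e := by rw [hη]; positivity
  have hes : e * s = 1 := by rw [hη]; field_simp
  have hm2 : 1 ≤ m ^ 2 := one_le_pow₀ hm
  -- All later bounds follow from this one: ηkℓ is small compared with Δ/m².
  have hekl : 408 * m ^ 2 * (e * k * ℓ) ≤ Δ := by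
    have h1 : 408 * m ^ 2 / Δ * k * ℓ ≤ s :=
      (mul_le_mul_of_nonneg_left hΛ (by positivity)).trans hs
    have h2 := mul_le_mul_of_nonneg_left h1 he0.le
    rw [hes] at h2
    have h3 : e * (408 * m ^ 2 / Δ * k * ℓ) = 408 * m ^ 2 * (e * k * ℓ) / Δ := by ring
    rwa [h3, div_le_one hΔ0] at h2
  have hekl0 : 0 ≤ e * k * ℓ := by positivity
  have hek0 : 0 ≤ e * k := by positivity
  have hek1 : e * k ≤ e * k * ℓ := le_mul_of_one_le_right hek0 hℓ
  have hekl1 : 408 * (e * k * ℓ) ≤ 1 := by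
    have : e * k * ℓ ≤ m ^ 2 * (e * k * ℓ) := le_mul_of_one_le_left hekl0 hm2
    linarith
  have hek : e * k ≤ 1 / 408 := by linarith
  have hβd : beta k μ δ T = 2 * e * √(6 * ℓ) := rfl
  have hβ1 : e ≤ beta k μ δ T := by
    have : 1 ≤ √(6 * ℓ) := Real.le_sqrt_of_sq_le (by linarith)
    rw [hβd]
    nlinarith
  have hβ2 : beta k μ δ T ≤ 5 * e * ℓ := by
    have : √(6 * ℓ) ≤ 5 / 2 * ℓ := Real.sqrt_le_iff.2 ⟨by linarith, by nlinarith⟩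
    rw [hβd]
    nlinarith
  have hβ3 : 44 * m * k * beta k μ δ T ≤ Δ := by
    have h1 : 44 * m * k * beta k μ δ T ≤ 44 * m * k * (5 * e * ℓ) := by gcongr
    have h2 : m * (e * k * ℓ) ≤ m ^ 2 * (e * k * ℓ) := by
      refine mul_le_mul_of_nonneg_right ?_ hekl0
      nlinarith
    have h3 : 0 ≤ m ^ 2 * (e * k * ℓ) := mul_nonneg (by positivity) hekl0
    linarith
  have hβ4 : beta k μ δ T ≤ 1 := by
    have h1 : e * ℓ ≤ e * k * ℓ := by nlinarith [mul_pos he0 (show 0 < ℓ by linarith)]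
    linarith
  have hγ : gamma k μ δ T ≤ 4 * e ^ 2 * k ^ 2 := by
    refine (min_le_right _ _).trans ?_
    have h1 : (1 + beta k μ δ T) ^ 2 ≤ 4 := by nlinarith
    have h2 : e ^ 2 * (1 + beta k μ δ T) ^ 2 ≤ e ^ 2 * 4 :=
      mul_le_mul_of_nonneg_left h1 (sq_nonneg e)
    have h3 := mul_le_mul_of_nonneg_right h2 (sq_nonneg (k : ℝ))
    linarith
  refine ⟨by linarith, hβ1, hβ2, hβ3, hγ, hγ.trans_lt ?_⟩
  nlinarith

/-- The final estimate of the regret in terms of the rate `s`. -/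
lemma regret_bound_arith {ℓ e β γ K t ρ S x c : ℝ} (hs0 : 0 < s) (hes : e = 1 / s)
    (hℓ : 1 ≤ ℓ) (hK : 1 ≤ K) (ht : 0 ≤ t) (hΔ0 : 0 < Δ)
    (hs2 : t ≤ s ^ 2) (hs3 : K ^ 2 * t ≤ s ^ 3) (heK : e * K ≤ 1)
    (hβ : β ≤ 5 * e * ℓ) (hγ : γ ≤ 4 * e ^ 2 * K ^ 2) (hx : x ≤ 2 * ℓ)
    (hlogK0 : 0 ≤ Real.log K) (hlogK : Real.log K ≤ ℓ) (hc : 0 ≤ c) (hS0 : 0 ≤ S)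
    (hS : S ≤ t * (c + 2 * (K * γ)) + K * (4 * Real.log K / (e * Δ) + 1))
    (hρ : e * ρ ≤ e * γ * t + 2 * x + Real.log K + (e * β + 8 * e ^ 2) * S) :
    ρ ≤ (9 + 13 * (c + 9 + 4 / Δ)) * ℓ ^ 4 * s := by
  have he0 : 0 < e := by rw [hes]; positivity
  have hes1 : e * s = 1 := by rw [hes]; field_simp
  have he2t : e ^ 2 * t ≤ 1 := by
    calc e ^ 2 * t ≤ e ^ 2 * s ^ 2 := by gcongr
      _ = 1 := by rw [← mul_pow, hes1, one_pow]
  have he3 : e ^ 3 * (K ^ 2 * t) ≤ 1 := by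
    calc e ^ 3 * (K ^ 2 * t) ≤ e ^ 3 * s ^ 3 := by gcongr
      _ = 1 := by rw [← mul_pow, hes1, one_pow]
  have he1 : e ≤ 1 := by nlinarith
  have h1 : e * γ * t ≤ 4 * ℓ := by
    have : e * γ * t ≤ e * (4 * e ^ 2 * K ^ 2) * t := by gcongr
    linarith
  have h2 : e ^ 2 * (t * (c + 2 * (K * γ))) ≤ c + 8 := by
    have h3 : t * (c + 2 * (K * γ)) ≤ t * (c + 2 * (K * (4 * e ^ 2 * K ^ 2))) := by gcongr
    -- The mixing contributes η⁴k³T = (ηk)(η³k²T), which combines ηk ≤ 1 with k²T ≤ s³.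
    have h4 : e * K * (e ^ 3 * (K ^ 2 * t)) ≤ 1 * 1 :=
      mul_le_mul heK he3 (by positivity) zero_le_one
    have h5 : e ^ 2 * t * c ≤ 1 * c := mul_le_mul_of_nonneg_right he2t hc
    have h6 := mul_le_mul_of_nonneg_left h3 (sq_nonneg e)
    linarith
  -- The initial phase, of length of order log k / (ηΔ), costs k per round; again ηk ≤ 1.
  have h3 : e ^ 2 * (K * (4 * Real.log K / (e * Δ) + 1)) ≤ 4 / Δ * ℓ + 1 := by
    have h4 : e ^ 2 * (K * (4 * Real.log K / (e * Δ) + 1)) =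
        e * K * (4 / Δ * Real.log K) + e * (e * K) := by
      field_simp
    have h5 : e * K * (4 / Δ * Real.log K) ≤ 1 * (4 / Δ * ℓ) := by gcongr
    have h6 : e * (e * K) ≤ 1 * 1 := mul_le_mul he1 heK (by positivity) zero_le_one
    linarith
  have h4 : e ^ 2 * S ≤ (c + 9 + 4 / Δ) * ℓ := by
    have h5 := mul_le_mul_of_nonneg_left hS (sq_nonneg e)
    have h6 : c + 9 ≤ (c + 9) * ℓ := le_mul_of_one_le_right (by linarith) hℓ
    linarith
  have h5 : (e * β + 8 * e ^ 2) * S ≤ 13 * ℓ * ((c + 9 + 4 / Δ) * ℓ) := by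
    have h6 : e * β ≤ e * (5 * e * ℓ) := by gcongr
    have h7 : e * β + 8 * e ^ 2 ≤ 13 * ℓ * e ^ 2 := by nlinarith [sq_nonneg e]
    calc _ ≤ 13 * ℓ * e ^ 2 * S := mul_le_mul_of_nonneg_right h7 hS0
      _ = 13 * ℓ * (e ^ 2 * S) := by ring
      _ ≤ _ := by gcongr
  -- Here 9 = 4 + 4 + 1 from ηγT, 2x and log k, and 13 = 5 + 8 from β and 8η². The power ℓ² would
  -- do; ℓ⁴ matches the short-horizon case.
  have h6 : e * ρ ≤ (9 + 13 * (c + 9 + 4 / Δ)) * ℓ ^ 4 := by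
    have hA : 0 ≤ 13 * (c + 9 + 4 / Δ) := by positivity
    have h7 : ℓ ≤ ℓ ^ 4 := le_self_pow₀ hℓ (by norm_num)
    have h8 : ℓ ^ 2 ≤ ℓ ^ 4 := pow_le_pow_right₀ hℓ (by norm_num)
    have h9 := mul_le_mul_of_nonneg_left h8 hA
    linarith
  calc ρ = e * ρ * s := by rw [mul_right_comm, hes1, one_mul]
    _ ≤ _ := mul_le_mul_of_nonneg_right h6 hs0.le

/-- Half of δ pays for the k + 1 ≤ 2k gain comparisons, half for the k(T + 1) ≤ 2kT contributions of
the barrier. -/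
lemma failure_bound_arith {K t lam x : ℝ} (hδ0 : 0 < δ) (hK : 1 ≤ K) (ht : 1 ≤ t)
    (hx : Real.exp (-x) = δ / (4 * K)) (hlam : Real.exp (-lam) ≤ δ / (4 * K * t)) :
    Real.exp (-x) * (K + 1) + K * Real.exp (-lam) + t * (K * Real.exp (-lam)) ≤ δ := by
  have h1 : Real.exp (-x) * (K + 1) ≤ δ / 2 := by
    rw [hx, div_mul_eq_mul_div, div_le_div_iff₀ (by positivity) two_pos]
    nlinarith
  have h2 : K * (t + 1) * Real.exp (-lam) ≤ δ / 2 := by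
    refine (mul_le_mul_of_nonneg_left hlam (by positivity)).trans ?_
    rw [← mul_div_assoc, div_le_div_iff₀ (by positivity) two_pos]
    have : 0 ≤ K * δ * (t - 1) := mul_nonneg (by positivity) (by linarith)
    linarith
  linarith

variable [NeZero k]

lemma regret_le_natCast {g : ℕ → Fin k → ℝ} (hg : ∀ t < T, ∀ i, g t i ∈ Set.Icc (0 : ℝ) 1)
    (h : Fin T → Fin k × Fin k) : regret T g h ≤ T := by
  have h1 : (⨆ i : Fin k, ∑ t : Fin T, g t i) ≤ T := ciSup_le fun i => by
    simpa using Finset.sum_le_sum fun (t : Fin T) (_ : t ∈ Finset.univ) => (hg t t.2 i).2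
  have h2 : 0 ≤ ∑ t : Fin T, g t (h t).1 := Finset.sum_nonneg fun t _ => (hg t t.2 _).1
  unfold regret
  linarith

/-- The summands are nonnegative, so each is below 1; in particular the barrier potential is not
frozen at 1 and no crossing has occurred. -/
lemma BarrierRegime.regret_le_of_failurePotential_lt_one {G : Finset (Fin k)} {lam x : ℝ}
    (H : BarrierRegime k μ δ T G Δ lam) (hG : G.Nonempty) (hx : 0 ≤ x)
    {g : ℕ → Fin k → ℝ} (hg : ∀ t < T, ∀ i, g t i ∈ Set.Icc (0 : ℝ) 1)
    {h : Fin T → Fin k × Fin k}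
    (hM : failurePotential k μ δ T (eta μ T * Δ) lam x G T g h < 1) :
    cumul k μ δ T (fun _ w _ _ => sqrtMass k μ δ T w ^ 2) g T h ≤
      T * (2 * ((G.card : ℝ) + 2) ^ 2 + 2 * (k * gamma k μ δ T)) +
        k * (4 * Real.log k / (eta μ T * Δ) + 1) ∧
    eta μ T * regret T g h ≤ eta μ T * gamma k μ δ T * T + 2 * x + Real.log k +
      (eta μ T * beta k μ δ T + 8 * eta μ T ^ 2) *
        cumul k μ δ T (fun _ w _ _ => sqrtMass k μ δ T w ^ 2) g T h := by
  have hk1 := one_le_cast_of_neZero (k := k)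
  have hm1 : (1 : ℝ) ≤ G.card := by exact_mod_cast hG.card_pos
  have hβ0 := H.beta_nonneg
  have hw := weight_pos (k := k) (μ := μ) (δ := δ) (T := T) g T h
  have hA : ∀ i, 0 ≤ Real.exp (eta μ T * cumul k μ δ T (fun _ _ y _ => y i) g T h) /
    weight k μ δ T g T h i := fun i => div_nonneg (Real.exp_pos _).le (hw i).le
  have hex := (Real.exp_pos (-x)).le
  have hsingle : ∀ i, Real.exp (-x) * (Real.exp (eta μ T * cumul k μ δ T (fun _ _ y _ => y i)
      g T h) / weight k μ δ T g T h i) ≤ Real.exp (-x) * ∑ i, Real.exp (eta μ T *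
      cumul k μ δ T (fun _ _ y _ => y i) g T h) / weight k μ δ T g T h i := fun i =>
    mul_le_mul_of_nonneg_left (Finset.single_le_sum (f := fun i => Real.exp (eta μ T *
      cumul k μ δ T (fun _ _ y _ => y i) g T h) / weight k μ δ T g T h i)
      (fun i _ => hA i) (Finset.mem_univ i)) hex
  have hp1 := mul_nonneg hex (Finset.sum_nonneg fun i (_ : i ∈ Finset.univ) => hA i)
  have hp2 := mul_nonneg hex (Real.exp_pos (cumul k μ δ T (fun _ w y a =>
    eta μ T * gainDiff k μ δ T w y a + -(4 * eta μ T ^ 2) * sqrtMass k μ δ T w ^ 2) g T h)).le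
  have hbar := barrierPotential_nonneg (μ := μ) (δ := δ) (T := T) (eta μ T * Δ) lam G T g h
  rw [failurePotential, mul_add] at hM
  have hviol : cumul k μ δ T (violation k μ δ T (eta μ T * Δ) G) g T h = 0 := by
    by_contra hcon
    rw [barrierPotential, if_neg hcon] at hM
    linarith
  refine ⟨cumul_sqrtMass_le hG (mul_pos H.eta_pos (H.gap_pos hG)) hviol,
    regret_le hg H.eta_pos hβ0 ?_ H.gamma_lt_one hx (fun i => ?_) ?_⟩
  · have h1 : k * beta k μ δ T ≤ 1 := by
      have h2 : k * beta k μ δ T ≤ G.card * (k * beta k μ δ T) :=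
        le_mul_of_one_le_left (by positivity) hm1
      have h3 : 0 ≤ k * beta k μ δ T := by positivity
      linarith [H.beta_le, H.gap_le_one]
    have h2 : beta k μ δ T ≤ k * beta k μ δ T := le_mul_of_one_le_left hβ0 hk1
    nlinarith
  · linarith [hsingle i]
  · linarith

lemma one_sub_le_lintegral_run {G : Finset (Fin k)} (hG : G.Nonempty) (hk : 2 ≤ k) (hT : 1 ≤ T)
    (hδ0 : 0 < δ) (hδ1 : δ < 1) (hΔ0 : 0 < Δ) (hΔ1 : Δ ≤ 1)
    (hη : eta μ T = 1 / s) (hs0 : 0 < s)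
    (hs : 408 * (G.card : ℝ) ^ 2 / Δ * k * Real.log (4 * k * T / δ) ≤ s)
    (hs2 : (T : ℝ) ≤ s ^ 2) (hs3 : (k : ℝ) ^ 2 * T ≤ s ^ 3)
    {ν : Measure (Fin k → ℝ)} [IsProbabilityMeasure ν]
    (hν : ∀ᵐ x ∂ν, ∀ i, x i ∈ Set.Icc (0 : ℝ) 1)
    (hgap : ∀ i ∈ G, ∀ j ∉ G, (∫ x, x j ∂ν) + Δ ≤ ∫ x, x i ∂ν)
    {Ω : Type*} [MeasurableSpace Ω] {P : Measure Ω} [IsProbabilityMeasure P]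
    {X : ℕ → Ω → Fin k → ℝ} (hX : ∀ t < T, ProbabilityTheory.HasLaw (X t) ν P)
    (hind : ProbabilityTheory.iIndepFun (fun t : Fin T => X t) P) {R : ℝ}
    (hR : (9 + 13 * (2 * ((G.card : ℝ) + 2) ^ 2 + 9 + 4 / Δ)) *
      Real.log (3 * k / δ) ^ 4 * s ≤ R) :
    ENNReal.ofReal (1 - δ) ≤
      ∫⁻ ω, (run k μ δ T (fun t => X t ω) T).toOuterMeasure
        {h | regret T (fun t => X t ω) h ≤ R} ∂P := by
  have hk' : (2 : ℝ) ≤ k := by exact_mod_cast hk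
  have hT' : (1 : ℝ) ≤ T := by exact_mod_cast hT
  have hk0 : (0 : ℝ) < k := by linarith
  have hm1 : (1 : ℝ) ≤ G.card := by exact_mod_cast hG.card_pos
  have hℓ := one_le_log_three_mul_div hk hδ0 hδ1
  obtain ⟨hηk, hηβ, hβ5, hβΔ, hγ4, hγ1⟩ :=
    parameter_bounds (μ := μ) hk hT hδ0 hδ1 hm1 hΔ0 hΔ1 hη hs0 hs
  have hη0 : 0 < eta μ T := by rw [hη]; positivity
  have hβ0 : 0 ≤ beta k μ δ T := hη0.le.trans hηβ
  -- The solution of `lam_eq` for η = 1/s; `hs` says exactly that it is at least log(4kT/δ).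
  set lam := Δ * s / (408 * (G.card : ℝ) ^ 2 * k) with hlam
  have hlam0 : 0 < lam := by positivity
  have H : BarrierRegime k μ δ T G Δ lam := by
    refine ⟨hΔ1, hη0, by nlinarith, hβ0, hβΔ, hγ1, hlam0, ?_⟩
    rw [hlam, hη]
    field_simp
  have hlamΛ : Real.log (4 * k * T / δ) ≤ lam := by
    rw [hlam, le_div_iff₀ (by positivity)]
    have h1 := mul_le_mul_of_nonneg_left hs hΔ0.le
    refine le_trans (le_of_eq ?_) h1
    field_simp
  set x := Real.log (4 * k / δ) with hx
  have hexpx : Real.exp (-x) = δ / (4 * k) := by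
    rw [Real.exp_neg, hx, Real.exp_log (by positivity), inv_div]
  have hx0 : 0 ≤ x := Real.log_nonneg (by rw [le_div_iff₀ hδ0]; linarith)
  have hx2 : x ≤ 2 * Real.log (3 * k / δ) := by
    have h1 : 4 * k / δ ≤ (3 * k / δ) ^ 2 := by
      rw [div_pow, div_le_div_iff₀ hδ0 (by positivity)]
      have h3 : δ ^ 2 ≤ δ := by nlinarith
      have h4 : (k : ℝ) ≤ k ^ 2 := by nlinarith
      nlinarith [mul_le_mul_of_nonneg_left h3 hk0.le, mul_le_mul_of_nonneg_right h4 hδ0.le]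
    have h2 := Real.log_le_log (by positivity) h1
    rw [Real.log_pow] at h2
    push_cast at h2
    exact h2
  have hexplam : Real.exp (-lam) ≤ δ / (4 * k * T) := by
    calc Real.exp (-lam) ≤ Real.exp (-Real.log (4 * k * T / δ)) :=
          Real.exp_le_exp.2 (neg_le_neg hlamΛ)
      _ = _ := by rw [Real.exp_neg, Real.exp_log (by positivity), inv_div]
  have hM0 : failurePotential k μ δ T (eta μ T * Δ) lam x G 0 0 Fin.elim0 +
      T * (k * Real.exp (-lam)) ≤ δ := by
    refine (add_le_add (failurePotential_zero_le hG hlam0.le) le_rfl).trans ?_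
    exact failure_bound_arith hδ0 (by linarith) hT' hexpx hexplam
  refine (H.isAlmostSupermartingale_failurePotential hG hgap hηβ hηk x).one_sub_le_lintegral hν
    (mul_nonneg hk0.le (Real.exp_pos _).le) hδ0.le hM0
    (good := fun g => {h | regret T g h ≤ R}) ?_ ?_ hX hind
  · exact fun g g' hg => setOf_regret_le_congr hg R
  · intro g hg h hM
    refine le_trans ?_ hR
    obtain ⟨hS, hreg⟩ := H.regret_le_of_failurePotential_lt_one hG hx0 hg hM
    refine regret_bound_arith hs0 hη hℓ (by linarith) T.cast_nonneg hΔ0 hs2 hs3 hηk hβ5 hγ4 hx2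
      (Real.log_nonneg (by linarith)) ?_ (by positivity)
      (cumul_nonneg (fun _ _ _ _ => sq_nonneg _) g T h) hS hreg
    refine Real.log_le_log hk0 ?_
    rw [le_div_iff₀ hδ0]
    linarith [mul_le_mul_of_nonneg_left hδ1.le hk0.le]

end Main

end

end DecoupledMAB

/-! ### Constants and regimes of the theorem -/

open DecoupledMAB

theorem theorem2 :
    ∃ a : ℕ, ∀ (m : ℕ) (Δ : ℝ), 0 < Δ → ∃ C : ℝ, 0 < C ∧
      ∀ (k : ℕ) [NeZero k] (T : ℕ) (δ : ℝ), 2 ≤ k → 1 ≤ T → 0 < δ → δ < 1 →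
      ∀ (G : Finset (Fin k)), G.Nonempty → G.card = m →
      -- `ν` is the law of the reward vector of one round
      ∀ (ν : MeasureTheory.Measure (Fin k → ℝ)) [MeasureTheory.IsProbabilityMeasure ν],
        (∀ᵐ x ∂ν, ∀ i, x i ∈ Set.Icc (0 : ℝ) 1) →
        (∀ i ∈ G, ∀ j ∉ G, (∫ x, x j ∂ν) + Δ ≤ ∫ x, x i ∂ν) →
      -- the reward vectors `X 0, …, X (T - 1)` are independent with law `ν`
      ∀ (Ω : Type*) [MeasurableSpace Ω] (P : MeasureTheory.Measure Ω)
        [MeasureTheory.IsProbabilityMeasure P] (X : ℕ → Ω → Fin k → ℝ),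
        (∀ t < T, ProbabilityTheory.HasLaw (X t) ν P) →
        ProbabilityTheory.iIndepFun (fun t : Fin T => X t) P →
      -- probability over the rewards and the internal randomness of the algorithm
      ENNReal.ofReal (1 - δ) ≤
        ∫⁻ ω, (DecoupledMAB.run k
            ((k : ℝ) ^ (min 1 (max 0 (4 / 3 - 1 / 3 * Real.logb k T)) : ℝ)) δ T
            (fun t => X t ω) T).toOuterMeasure
          {h | DecoupledMAB.regret T (fun t => X t ω) h ≤
            C * Real.log (3 * k / δ) ^ a *
              √((k : ℝ) ^ (max 0 (4 / 3 - 1 / 3 * Real.logb k T) : ℝ) * T)} ∂P := by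
  refine ⟨4, fun m Δ' hΔ' => ?_⟩
  -- The gap may exceed 1 only when G contains all arms and the gap condition is vacuous; capping it
  -- weakens the hypothesis.
  set Δ := min Δ' 1 with hΔ
  have hΔ0 : 0 < Δ := lt_min hΔ' one_pos
  have hΔ1 : Δ ≤ 1 := min_le_right _ _
  set C₁ : ℝ := 9 + 13 * (2 * ((m : ℝ) + 2) ^ 2 + 9 + 4 / Δ) with hC₁
  have hC₁1 : 1 ≤ C₁ := by
    have : 0 ≤ 13 * (2 * ((m : ℝ) + 2) ^ 2 + 9 + 4 / Δ) := by positivity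
    linarith
  set C₀ : ℝ := 408 * (m : ℝ) ^ 2 / Δ with hC₀
  have hC₀0 : 0 ≤ C₀ := by positivity
  refine ⟨C₁ + (8 * C₀) ^ 4, by positivity, ?_⟩
  intro k _ T δ hk hT hδ0 hδ1 G hG hGm ν _ hν hgap Ω _ P _ X hX hind
  have hm1 : (1 : ℝ) ≤ m := by rw [← hGm]; exact_mod_cast hG.card_pos
  have hk' : (2 : ℝ) ≤ k := by exact_mod_cast hk
  have hT' : (1 : ℝ) ≤ T := by exact_mod_cast hT
  have hℓ := one_le_log_three_mul_div hk hδ0 hδ1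
  have hs3 := sq_mul_le_rate_pow_three hk hT
  have hs2 := natCast_le_rate_sq (T := T) hk
  have hmin := fun hkT : k ≤ T => min_one_exponent hk hkT
  set E := max 0 (4 / 3 - 1 / 3 * Real.logb k T) with hE
  set s := √((k : ℝ) ^ E * T) with hs
  have hs0 : 0 < s := Real.sqrt_pos.2 (mul_pos (Real.rpow_pos_of_pos (by linarith) _) (by linarith))
  have hℓ4 : 1 ≤ Real.log (3 * k / δ) ^ 4 := one_le_pow₀ hℓ
  have hC₀4 : 0 ≤ (8 * C₀) ^ 4 := by positivity
  -- The second condition makes λ ≥ log(4kT/δ). If either fails, T is at most the claimed bound.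
  by_cases hmain : k ≤ T ∧ C₀ * k * Real.log (4 * k * T / δ) ≤ s
  · obtain ⟨hkT, hsΛ⟩ := hmain
    refine one_sub_le_lintegral_run hG hk hT hδ0 hδ1 hΔ0 hΔ1 (s := s) ?_ hs0 ?_ hs2 hs3 hν
      (fun i hi j hj => ?_) hX hind ?_
    · rw [eta, hmin hkT]
    · rw [hGm]; exact hsΛ
    · exact (add_le_add le_rfl (min_le_left _ _)).trans (hgap i hi j hj)
    · rw [hGm]
      refine mul_le_mul_of_nonneg_right (mul_le_mul_of_nonneg_right ?_ (by linarith)) hs0.le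
      linarith
  · have hTle : (T : ℝ) ≤ (C₁ + (8 * C₀) ^ 4) * Real.log (3 * k / δ) ^ 4 * s := by
      by_cases hkT : k ≤ T
      · have hsΛ : s < C₀ * k * Real.log (4 * k * T / δ) := by
          by_contra! hcon
          exact hmain ⟨hkT, hcon⟩
        refine (natCast_le_of_rate_lt hk hkT hδ0 hδ1 hs0 hs3 (by positivity) hsΛ).trans ?_
        refine mul_le_mul_of_nonneg_right (mul_le_mul_of_nonneg_right ?_ (by linarith)) hs0.le
        linarith
      · have hTk : (T : ℝ) ≤ k := by exact_mod_cast (not_le.1 hkT).le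
        have h1 : (T : ℝ) ≤ s := by
          -- For T ≤ k: T³ ≤ k²T ≤ s³.
          refine (pow_le_pow_iff_left₀ (by linarith) hs0.le three_ne_zero).1 (le_trans ?_ hs3)
          have := pow_le_pow_left₀ (by linarith) hTk 2
          nlinarith
        have h2 : 1 ≤ (C₁ + (8 * C₀) ^ 4) * Real.log (3 * k / δ) ^ 4 :=
          one_le_mul_of_one_le_of_one_le (by linarith) hℓ4
        exact h1.trans (le_mul_of_one_le_left hs0.le h2)
    -- The regret is at most T for all rewards in the cube, so the zero process serves as potential.
    refine IsAlmostSupermartingale.zero.one_sub_le_lintegral hν le_rfl hδ0.le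
      (by simpa using hδ0.le) (good := fun g => {h | regret T g h ≤
        (C₁ + (8 * C₀) ^ 4) * Real.log (3 * k / δ) ^ 4 * s}) ?_ ?_ hX hind
    · exact fun g g' hg => setOf_regret_le_congr hg _
    · intro g hg h _
      exact (regret_le_natCast hg h).trans hTle
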